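/- **Setting.** Let $\omega=(\omega_x)_{x\in\mathbb Z}$ be i.i.d. random variables with values in $(0,1)$, with law $\mathbf P$ and expectation $\mathbf E$. Put $\omega_x^-=1-\omega_x$ and let either $\omega_x^+=\omega_x$ for all $x$, or $\omega_x^+=\omega_{x+1}$ for all $x$ (the statement holds for each of the two conventions). Let $N\ge 1$ and let $L$ be a finite subset of $\{(x_1,\dots,x_N)\in\mathbb Z^N : x_1=0\}$. For $z\in\mathbb Z$ let $$L_z=\{(z,x_2,\dots,x_N)\in\mathbb Z^N : (0,x_2-z,\dots,x_N-z)\in L\},\qquad \mathcal V=\bigcup_{z\in\mathbb Z}L_z .$$ For $\mathbf x,\mathbf y\in\mathcal V$ define rates as follows: if $\|\mathbf x-\mathbf y\|_1=1$ and $i$ is the coordinate with $x_i\ne y_i$, then $q(\mathbf x,\mathbf y)=\omega^+_{x_i}$ if $y_i=x_i+1$ and $q(\mathbf x,\mathbf y)=\omega^-_{x_i}$ if $y_i=x_i-1$; otherwise $q(\mathbf x,\mathbf y)=0$. The spider graph has vertex set $\mathcal V$ and an edge between $\mathbf x$ and $\mathbf y$ if and only if $q(\mathbf x,\mathbf y)>0$.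 Given $\omega$, the spider $S(t)=(S_1(t),\dots,S_N(t))$, $t\ge 0$, started from $\mathbf x\in\mathcal V$, is the continuous-time Markov jump process on $\mathcal V$ with rates $q$; its law is the quenched law $\mathtt P_\omega^{\mathbf x}$, and $\mathbb P^{\mathbf x}=\mathbf P\times\mathtt P_\omega^{\mathbf x}$ is the annealed law. **Proposition 2.1.** Assume that 1. (i) for $\mathbf P$-almost every $\omega$, $L$ induces a connected subgraph of the spider graph; 2. (ii) for $\mathbf P$-almost every $\omega$, there is at least one edge of the spider graph between $L$ and $L_1$; 3. (iii) $\mathbf E[\ln\rho_0]<0$, where $\rho_0=\omega_0^- /\omega_0^+$; 4. (iv) there exists $0<\delta<1/2$ such that $\mathbf P[\delta\le\omega_0^+\le 1-\delta]=1$. Then for every starting configuration $\mathbf x\in\mathcal V$ the spider is transient to the right: $$\lim_{t\to\infty}S_1(t)=+\infty\qquad \mathbb P^{\mathbf x}\text{-a.s.}$$ -/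

import Mathlib

open MeasureTheory ProbabilityTheory Filter
open scoped ENNReal NNReal

noncomputable section

namespace Spider

/-- An environment: a family `(ω_x)_{x ∈ ℤ}` of numbers in `(0,1)`. -/
abbrev Env : Type := ℤ → Set.Ioo (0 : ℝ) 1

/-- The law of an i.i.d. environment whose one-site marginal is `μ`. -/
def envLaw (μ : Measure (Set.Ioo (0 : ℝ) 1)) [IsProbabilityMeasure μ] : Measure Env :=
  Measure.infinitePi fun _ : ℤ => μ

/-- The rate `ω_x^+` of a jump from `x` to `x + 1`. The two values of `s` in use are `s = 0`
(`ω_x^+ = ω_x`) and `s = 1` (`ω_x^+ = ω_{x+1}`). -/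
def wPlus (s : ℤ) (ω : Env) (x : ℤ) : ℝ := (ω (x + s) : ℝ)

/-- The rate `ω_x^-` of a jump from `x` to `x - 1`. -/
def wMinus (ω : Env) (x : ℤ) : ℝ := 1 - (ω x : ℝ)

variable {N : ℕ}

/-- The transition rate from `x` to `y`. It vanishes unless the `ℓ¹` distance of `x` and `y` is `1`;
if it is `1`, then exactly one coordinate `i` has `x i ≠ y i`, and the sum has the single non-zero
term `ω^±_{x_i}`, according to whether `y i = x i ± 1`. -/
def rate (s : ℤ) (ω : Env) (x y : Fin N → ℤ) : ℝ :=
  if ∑ i, |x i - y i| = 1 then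
    ∑ i, (if y i = x i + 1 then wPlus s ω (x i) else if y i = x i - 1 then wMinus ω (x i) else 0)
  else 0

variable [NeZero N]

/-- The local configurations at `z`: the translate `Θ_z L` of `L`. The leg with index `0` is the
first leg, whose position is the position of the spider. -/
def localConf (L : Finset (Fin N → ℤ)) (z : ℤ) : Set (Fin N → ℤ) :=
  {x | x 0 = z ∧ (fun i => x i - z) ∈ L}

/-- The state space `𝒱 = ⋃_z L_z` of the spider. -/
abbrev Vert (L : Finset (Fin N → ℤ)) : Type := {x : Fin N → ℤ // ∃ z : ℤ, x ∈ localConf L z}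

theorem wPlus_pos (s : ℤ) (ω : Env) (x : ℤ) : 0 < wPlus s ω x := (ω (x + s)).2.1

theorem wMinus_pos (ω : Env) (x : ℤ) : 0 < wMinus ω x := by
  have := (ω x).2.2
  unfold wMinus
  linarith

theorem rate_pos_iff {M : ℕ} (s : ℤ) (ω : Env) (x y : Fin M → ℤ) :
    0 < rate s ω x y ↔ ∑ i, |x i - y i| = 1 := by
  unfold rate
  split_ifs with h
  · simp only [h, iff_true]
    have hle : ∀ i, |x i - y i| ≤ 1 := fun i => by
      rw [← h]
      exact Finset.single_le_sum (f := fun i => |x i - y i|) (fun j _ => abs_nonneg _)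
        (Finset.mem_univ i)
    have hex : ∃ i, x i ≠ y i := by
      by_contra! hc
      simp [hc] at h
    obtain ⟨i, hi⟩ := hex
    refine Finset.sum_pos' (fun j _ => ?_) ⟨i, Finset.mem_univ i, ?_⟩
    · split_ifs
      · exact (wPlus_pos s ω _).le
      · exact (wMinus_pos ω _).le
      · exact le_rfl
    · have h1 := abs_le.1 (hle i)
      split_ifs with h2 h3
      · exact wPlus_pos s ω _
      · exact wMinus_pos ω _
      · omega
  · simp [h]

/-- The spider graph: an edge joins `x` and `y` if and only if the rate from `x` to `y` is
positive. -/
def spiderGraph (s : ℤ) (L : Finset (Fin N → ℤ)) (ω : Env) : SimpleGraph (Vert L) where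
  Adj x y := 0 < rate s ω x.1 y.1
  symm := ⟨by
    intro x y h
    rw [rate_pos_iff] at h ⊢
    rw [← h]
    exact Finset.sum_congr rfl fun i _ => abs_sub_comm _ _⟩
  loopless := ⟨by
    intro x h
    rw [rate_pos_iff] at h
    simp at h⟩

/-- The total rate at which the spider leaves `x`. -/
def totalRate (s : ℤ) (L : Finset (Fin N → ℤ)) (ω : Env) (x : Vert L) : ℝ≥0∞ :=
  ∑' y : Vert L, ENNReal.ofReal (rate s ω x.1 y.1)

theorem totalRate_ne_top (s : ℤ) (L : Finset (Fin N → ℤ)) (ω : Env) (x : Vert L) :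
    totalRate s L ω x ≠ ∞ := by
  have hfin : (Function.support fun y : Vert L => rate s ω x.1 y.1).Finite := by
    refine Set.Finite.subset (Set.Finite.preimage Subtype.val_injective.injOn
      (Set.finite_Icc (x.1 - 1) (x.1 + 1))) fun y hy => ?_
    have h : ∑ i, |x.1 i - y.1 i| = 1 := by
      by_contra hc
      exact hy (by simp [rate, hc])
    have hle : ∀ i, |x.1 i - y.1 i| ≤ 1 := fun i => by
      rw [← h]
      exact Finset.single_le_sum (f := fun i => |x.1 i - y.1 i|) (fun j _ => abs_nonneg _)
        (Finset.mem_univ i)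
    refine ⟨fun i => ?_, fun i => ?_⟩
    · have := abs_le.1 (hle i)
      simp only [Pi.sub_apply, Pi.one_apply]
      omega
    · have := abs_le.1 (hle i)
      simp only [Pi.add_apply, Pi.one_apply]
      omega
  exact (summable_of_hasFiniteSupport hfin).tsum_ofReal_ne_top

/-- The jump distribution from `x`: `y` has probability `q(x,y) / ∑_z q(x,z)`. A state that cannot
be left is absorbing. -/
def jumpPMF (s : ℤ) (L : Finset (Fin N → ℤ)) (ω : Env) (x : Vert L) : PMF (Vert L) :=
  if h : totalRate s L ω x = 0 then PMF.pure x
  else PMF.normalize (fun y : Vert L => ENNReal.ofReal (rate s ω x.1 y.1)) h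
    (totalRate_ne_top s L ω x)

/-- The transition kernel of the jump chain in the environment `ω`, as a function of the past: it
depends on the last state only. -/
def jumpKernel (s : ℤ) (L : Finset (Fin N → ℤ)) (ω : Env) (n : ℕ) :
    Kernel ((i : Finset.Iic n) → (fun _ : ℕ => Vert L) i) (Vert L) :=
  (Kernel.ofFunOfCountable fun x : Vert L => (jumpPMF s L ω x).toMeasure).comap
    (fun h => h ⟨n, Finset.mem_Iic.2 le_rfl⟩) (measurable_pi_apply _)

instance (s : ℤ) (L : Finset (Fin N → ℤ)) (ω : Env) (n : ℕ) :
    IsMarkovKernel (jumpKernel s L ω n) :=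
  ⟨fun h => by
    rw [jumpKernel, Kernel.comap_apply]
    exact PMF.toMeasure.isProbabilityMeasure _⟩

/-- The law of the jump chain `(Ξ_n)_{n ≥ 0}` started from `x` in the environment `ω`. -/
def chainLaw (s : ℤ) (L : Finset (Fin N → ℤ)) (ω : Env) (x : Vert L) : Measure (ℕ → Vert L) :=
  Kernel.trajMeasure (X := fun _ => Vert L) (Measure.dirac x) (jumpKernel s L ω)

instance (s : ℤ) (L : Finset (Fin N → ℤ)) (ω : Env) (x : Vert L) :
    IsProbabilityMeasure (chainLaw s L ω x) := by
  unfold chainLaw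
  infer_instance

/-- The finite-dimensional distributions of the jump chain are those of the Markov chain started
from `x` with the jump distributions above. -/
theorem chainLaw_path (s : ℤ) (L : Finset (Fin N → ℤ)) (ω : Env) (x : Vert L) (y : ℕ → Vert L)
    (n : ℕ) :
    chainLaw s L ω x {f | ∀ i ≤ n, f i = y i} =
      if y 0 = x then ∏ i ∈ Finset.range n, jumpPMF s L ω (y i) (y (i + 1)) else 0 := by
  induction n with
  | zero =>
    have h0 : {f : ℕ → Vert L | ∀ i ≤ 0, f i = y i} = (fun f => f 0) ⁻¹' {y 0} := by
      ext f; simp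
    have h1 : (chainLaw s L ω x).map (fun f => f 0) = Measure.dirac x := by
      have h2 : (fun f : ℕ → Vert L => f 0) =
          (fun h : (i : Finset.Iic 0) → (fun _ : ℕ => Vert L) i => h ⟨0, by simp⟩) ∘
            Preorder.frestrictLe (π := fun _ => Vert L) 0 := rfl
      have h3 : (Measure.dirac x).map (MeasurableEquiv.piUnique
          fun i : Finset.Iic 0 => (fun _ : ℕ => Vert L) i).symm = Measure.dirac fun _ => x :=
        Measure.map_dirac' (MeasurableEquiv.measurable _) x
      rw [chainLaw, Kernel.trajMeasure, h3, Measure.dirac_bind (Kernel.measurable _), h2,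
        ← Measure.map_map (measurable_pi_apply _) (by fun_prop), Kernel.traj_map_frestrictLe_apply,
        Kernel.partialTraj_self, Kernel.id_apply]
      exact Measure.map_dirac' (measurable_pi_apply _) _
    rw [h0, ← Measure.map_apply (by fun_prop) (measurableSet_singleton _), h1,
      Measure.dirac_apply' _ (measurableSet_singleton _)]
    by_cases h : y 0 = x
    · simp [h]
    · simp [h, Ne.symm h]
  | succ n ih =>
    have h0 : {f : ℕ → Vert L | ∀ i ≤ n + 1, f i = y i} =
        (fun f => (Preorder.frestrictLe (π := fun _ => Vert L) n f, f (n + 1))) ⁻¹'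
          ({Preorder.frestrictLe (π := fun _ => Vert L) n y} ×ˢ {y (n + 1)}) := by
      ext f
      simp only [Set.mem_ofPred_eq, Set.mem_preimage, Set.mem_prod, Set.mem_singleton_iff,
        funext_iff, Preorder.frestrictLe_apply, Subtype.forall, Finset.mem_Iic]
      constructor
      · exact fun h => ⟨fun i hi => h i (by omega), h _ le_rfl⟩
      · rintro ⟨h1, h2⟩ i hi
        rcases Nat.lt_or_ge n i with h | h
        · obtain rfl : i = n + 1 := by omega
          exact h2
        · exact h1 i h
    have h1 : {f : ℕ → Vert L | ∀ i ≤ n, f i = y i} =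
        Preorder.frestrictLe (π := fun _ => Vert L) n ⁻¹'
          {Preorder.frestrictLe (π := fun _ => Vert L) n y} := by
      ext f
      simp [funext_iff]
    have hm := Kernel.map_frestrictLe_trajMeasure_compProd_eq_map_trajMeasure
      (X := fun _ => Vert L) (μ₀ := Measure.dirac x) (κ := jumpKernel s L ω) (a := n)
    rw [h1, ← Measure.map_apply (by fun_prop) (measurableSet_singleton _)] at ih
    rw [h0, ← Measure.map_apply (Measurable.prodMk (by fun_prop) (by fun_prop))
      ((measurableSet_singleton _).prod (measurableSet_singleton _)), chainLaw, ← hm,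
      Measure.compProd_apply_prod (measurableSet_singleton _) (measurableSet_singleton _),
      lintegral_singleton]
    rw [← chainLaw, ih]
    have hk : jumpKernel s L ω n (Preorder.frestrictLe (π := fun _ => Vert L) n y) {y (n + 1)} =
        jumpPMF s L ω (y n) (y (n + 1)) :=
      PMF.toMeasure_apply_singleton _ _ (measurableSet_singleton _)
    rw [hk, Finset.prod_range_succ]
    split_ifs
    · exact mul_comm _ _
    · exact mul_zero _

theorem measurable_rate {M : ℕ} (s : ℤ) (x y : Fin M → ℤ) : Measurable fun ω => rate s ω x y := by
  unfold rate wPlus wMinus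
  split_ifs
  · refine Finset.measurable_sum _ fun i _ => ?_
    split_ifs <;> fun_prop
  · exact measurable_const

theorem measurable_totalRate (s : ℤ) (L : Finset (Fin N → ℤ)) (x : Vert L) :
    Measurable fun ω => totalRate s L ω x :=
  Measurable.tsum fun y => (measurable_rate s x.1 y.1).ennreal_ofReal

theorem measurable_jumpPMF (s : ℤ) (L : Finset (Fin N → ℤ)) (x y : Vert L) :
    Measurable fun ω => jumpPMF s L ω x y := by
  have h : (fun ω => jumpPMF s L ω x y) = fun ω =>
      if totalRate s L ω x = 0 then PMF.pure x y
      else ENNReal.ofReal (rate s ω x.1 y.1) * (totalRate s L ω x)⁻¹ := by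
    ext ω
    unfold jumpPMF
    split_ifs
    · rfl
    · rfl
  rw [h]
  exact Measurable.ite (measurable_totalRate s L x (measurableSet_singleton 0)) measurable_const
    ((measurable_rate s x.1 y.1).ennreal_ofReal.mul (measurable_totalRate s L x).inv)

theorem measurable_chainLaw (s : ℤ) (L : Finset (Fin N → ℤ)) (x : Vert L) :
    Measurable fun ω => chainLaw s L ω x := by
  refine Measurable.measure_of_isPiSystem_of_isProbabilityMeasure
    generateFrom_measurableCylinders.symm isPiSystem_measurableCylinders fun A hA => ?_
  rw [measurableCylinders_nat] at hA
  simp only [Set.mem_iUnion, Set.mem_singleton_iff] at hA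
  obtain ⟨n, S, -, rfl⟩ := hA
  have hS : ∀ ω, chainLaw s L ω x (cylinder (Finset.Iic n) S) = ∑' a : S,
      chainLaw s L ω x {f | ∀ i ≤ n, f i = if h : i ≤ n then a.1 ⟨i, Finset.mem_Iic.2 h⟩ else x} := by
    intro ω
    have hset : ∀ a : (i : Finset.Iic n) → Vert L,
        {f : ℕ → Vert L | ∀ i ≤ n, f i = if h : i ≤ n then a ⟨i, Finset.mem_Iic.2 h⟩ else x} =
          Preorder.frestrictLe (π := fun _ => Vert L) n ⁻¹' {a} := by
      intro a
      ext f
      simp only [Set.mem_ofPred_eq, Set.mem_preimage, Set.mem_singleton_iff, funext_iff,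
        Preorder.frestrictLe_apply, Subtype.forall, Finset.mem_Iic]
      exact forall₂_congr fun i hi => by rw [dif_pos hi]
    simp only [hset]
    exact (tsum_measure_preimage_singleton S.to_countable fun a _ =>
      (Preorder.measurable_frestrictLe n) (measurableSet_singleton a)).symm
  simp only [hS, chainLaw_path]
  have hy : ∀ y : ℕ → Vert L, Measurable fun ω =>
      if y 0 = x then ∏ i ∈ Finset.range n, jumpPMF s L ω (y i) (y (i + 1)) else 0 := by
    intro y
    split_ifs
    · exact Finset.measurable_prod _ fun i _ => measurable_jumpPMF s L _ _
    · exact measurable_const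
  exact Measurable.tsum fun a => hy fun i => if h : i ≤ n then a.1 ⟨i, Finset.mem_Iic.2 h⟩ else x

/-- The quenched law of the spider started from `x`, as a kernel from environments to pairs of a
jump chain and an independent sequence of i.i.d. exponential variables of parameter `1`. -/
def quenchedLaw (s : ℤ) (L : Finset (Fin N → ℤ)) (x : Vert L) :
    Kernel Env ((ℕ → Vert L) × (ℕ → ℝ)) :=
  (⟨fun ω => chainLaw s L ω x, measurable_chainLaw s L x⟩ : Kernel Env (ℕ → Vert L)) ×ₖ
    Kernel.const Env (Measure.infinitePi fun _ : ℕ => expMeasure 1)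

instance : IsProbabilityMeasure (expMeasure 1) := isProbabilityMeasure_expMeasure one_pos

instance (s : ℤ) (L : Finset (Fin N → ℤ)) (x : Vert L) : IsMarkovKernel (quenchedLaw s L x) := by
  have : IsMarkovKernel
      (⟨fun ω => chainLaw s L ω x, measurable_chainLaw s L x⟩ : Kernel Env (ℕ → Vert L)) :=
    ⟨fun ω => inferInstanceAs (IsProbabilityMeasure (chainLaw s L ω x))⟩
  unfold quenchedLaw
  infer_instance

/-- The annealed law `𝐏 × 𝙿_ω^x`. -/
def annealedLaw (μ : Measure (Set.Ioo (0 : ℝ) 1)) [IsProbabilityMeasure μ] (s : ℤ)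
    (L : Finset (Fin N → ℤ)) (x : Vert L) : Measure (Env × ((ℕ → Vert L) × (ℕ → ℝ))) :=
  envLaw μ ⊗ₘ quenchedLaw s L x

instance (μ : Measure (Set.Ioo (0 : ℝ) 1)) [IsProbabilityMeasure μ] (s : ℤ)
    (L : Finset (Fin N → ℤ)) (x : Vert L) : IsProbabilityMeasure (annealedLaw μ s L x) := by
  unfold annealedLaw envLaw
  infer_instance

/-- The time of the `n`-th jump: given the jump chain, the holding times `E_k / q(Ξ_k)` are
independent and exponential with parameter the total rate `q(Ξ_k)` at `Ξ_k`. -/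
def jumpTime (s : ℤ) (L : Finset (Fin N → ℤ)) (ω : Env) (p : (ℕ → Vert L) × (ℕ → ℝ)) (n : ℕ) :
    ℝ≥0∞ :=
  ∑ k ∈ Finset.range n, ENNReal.ofReal (p.2 k) / totalRate s L ω (p.1 k)

/-- The spider `S(t)`: it is at `Ξ_n` for `T_n ≤ t < T_{n+1}`, where `T_n` is the time of the `n`-th
jump. The rates are bounded, so that almost surely such an `n` exists for every `t`. -/
def spider (s : ℤ) (L : Finset (Fin N → ℤ)) (ω : Env) (p : (ℕ → Vert L) × (ℕ → ℝ)) (t : ℝ≥0) :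
    Vert L :=
  p.1 (sInf {n : ℕ | (t : ℝ≥0∞) < jumpTime s L ω p (n + 1)})

end Spider

end

/-!
The spider walk is reversible. For a single leg, detailed balance holds for the weights
`exp (U x)` (times a bounded factor), where the potential `U` has increments
`log (ω_x / (1 - ω_x)) = -log ρ_x`; for the spider, the weight of a configuration is the product of
the weights of its legs (`conductance_comm`). Since the legs stay together, ellipticity makes all
conductances at level `z` comparable to `exp (N * U z)` (`exists_conductance_bounds`), and by the law
of large numbers `U` grows linearly to the right and tends to `-∞` to the left
(`ae_envLaw_potential`).

Fix a level `a` and minimise the Dirichlet energy among the functions that equal `1` on the levels up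
to `a`, take values in `[0,1]` and vanish to the right. A minimiser `u` exists by compactness and is
superharmonic (`exists_superharmonic`). Its energy is at most that of the indicator of the levels up
to `a`, which is of order `exp (N * U a)`, and each of its increments along an edge is at most the
square root of the energy divided by the conductance. Summing the increments along a path to the right
gives `u x ≤ C * exp (N * U a / 2) * ∑_{k ≥ x} exp (-N * U k / 2)` (`le_of_energy_le`), which vanishes
as `x → ∞`, and also as `a → -∞` for fixed `x` (`exists_excessive`).

By the maximum principle `u` is not harmonic everywhere, and the expected number of visits to a vertex
where it fails to be harmonic is finite (`tsum_chainLaw_ne_top_of_defect`). By irreducibility every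
vertex is visited finitely often, so that the level of the jump chain tends to `+∞` or to `-∞`. The
probability of the latter is at most `u x` for each such `u` (`chainLaw_tendsto_atBot_le`), hence it
vanishes. Finally the total rates are bounded, so that the jump times are finite and tend to infinity
(`tendsto_spider`), and the limit of the jump chain is that of the spider.
-/

noncomputable section

open scoped Topology

namespace Spider

/-! ### Dirichlet energy and equilibrium potentials -/

section Energy

variable {V : Type*}

/-- The Dirichlet energy of `h` on the network with conductances `c`. Every edge is counted twice,
once for each orientation. -/
def energy (c : V → V → ℝ) (h : V → ℝ) : ℝ≥0∞ :=
  ∑' p : V × V, ENNReal.ofReal (c p.1 p.2 * (h p.1 - h p.2) ^ 2)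

theorem lowerSemicontinuous_energy (c : V → V → ℝ) : LowerSemicontinuous (energy c) := by
  refine lowerSemicontinuous_tsum fun p => Continuous.lowerSemicontinuous ?_
  exact ENNReal.continuous_ofReal.comp (by fun_prop)

/-- The drop of `h` along an edge is controlled by the energy. -/
theorem conductance_mul_sq_le_energy {c : V → V → ℝ} {h : V → ℝ} {E : ℝ} (hE : 0 ≤ E)
    (hle : energy c h ≤ ENNReal.ofReal E) (x y : V) : c x y * (h x - h y) ^ 2 ≤ E :=
  (ENNReal.ofReal_le_ofReal_iff hE).1 <| (ENNReal.le_tsum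
    (f := fun p : V × V => ENNReal.ofReal (c p.1 p.2 * (h p.1 - h p.2) ^ 2)) (x, y)).trans hle

open Classical in
/-- Replacing the value of `u` at `x` by the `c x`-weighted average `t` of its neighbours lowers the
energy by twice the total conductance times the square of the change. -/
theorem hasSum_energy_update {c : V → V → ℝ} (symm : ∀ x y, c x y = c y x) (diag : ∀ x, c x x = 0)
    {u : V → ℝ} {x : V} {m t : ℝ} (hm : HasSum (c x) m) (hmt : HasSum (fun y => c x y * u y) (m * t))
    {e : ℝ} (he : HasSum (fun p : V × V => c p.1 p.2 * (u p.1 - u p.2) ^ 2) e) :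
    HasSum (fun p : V × V => c p.1 p.2 *
      (Function.update u x t p.1 - Function.update u x t p.2) ^ 2) (e - 2 * (m * (t - u x) ^ 2)) := by
  set g : V → ℝ := fun y => c x y * (t ^ 2 - u x ^ 2) - 2 * (t - u x) * (c x y * u y) with hg
  have hgs : HasSum g (-(m * (t - u x) ^ 2)) := by
    have := (hm.mul_right (t ^ 2 - u x ^ 2)).sub (hmt.mul_left (2 * (t - u x)))
    have h0 : -(m * (t - u x) ^ 2) = m * (t ^ 2 - u x ^ 2) - 2 * (t - u x) * (m * t) := by ring
    rw [h0]
    exact this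
  have h1 : HasSum (fun p : V × V => if p.1 = x then g p.2 else 0) (-(m * (t - u x) ^ 2)) := by
    have hi : Function.Injective fun y : V => (x, y) := Prod.mk_right_injective x
    rw [← hi.hasSum_iff]
    · simpa [Function.comp_def] using hgs
    · rintro ⟨a, b⟩ hab
      have : a ≠ x := fun h => hab ⟨b, by simp [h]⟩
      simp [this]
  have h2 : HasSum (fun p : V × V => if p.2 = x then g p.1 else 0) (-(m * (t - u x) ^ 2)) := by
    have hi : Function.Injective fun y : V => (y, x) := Prod.mk_left_injective x
    rw [← hi.hasSum_iff]
    · simpa [Function.comp_def] using hgs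
    · rintro ⟨a, b⟩ hab
      have : b ≠ x := fun h => hab ⟨a, by simp [h]⟩
      simp [this]
  have h3 := (he.add h1).add h2
  convert h3 using 1
  · ext ⟨a, b⟩
    by_cases ha : a = x <;> by_cases hb : b = x
    · subst ha hb
      simp [hg, diag]
    · subst ha
      simp [hg, hb]
      ring
    · subst hb
      simp [hg, ha, symm a b]
      ring
    · simp [ha, hb]
  · ring

/-- The equilibrium potential of `A`. Suppose that every function vanishing along the filter `F` of
neighbourhoods of infinity, with energy at most that of the indicator of `A`, is bounded by a
function `R` which itself vanishes along `F`. Then there is a superharmonic function `u` with values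
in `[0,1]`, equal to `1` on `A` and bounded by `R`: a minimiser of the energy. -/
theorem exists_superharmonic {c : V → V → ℝ} (nonneg : ∀ x y, 0 ≤ c x y)
    (symm : ∀ x y, c x y = c y x) (diag : ∀ x, c x x = 0) (hs : ∀ x, Summable (c x))
    {F : Filter V} (hF : F ≤ cofinite) {A : Set V} (hA : Tendsto (A.indicator fun _ => (1 : ℝ)) F (𝓝 0))
    (hAE : energy c (A.indicator fun _ => (1 : ℝ)) ≠ ∞) {R : V → ℝ} (hR0 : Tendsto R F (𝓝 0))
    (hR : ∀ h : V → ℝ, Tendsto h F (𝓝 0) → energy c h ≤ energy c (A.indicator fun _ => (1 : ℝ)) →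
      ∀ x, h x ≤ R x) :
    ∃ u : V → ℝ, (∀ x, 0 ≤ u x) ∧ (∀ x, u x ≤ 1) ∧ (∀ x ∈ A, u x = 1) ∧ (∀ x, u x ≤ R x) ∧
      ∀ x, ∑' y, c x y * u y ≤ (∑' y, c x y) * u x := by
  classical
  let S : Set (V → ℝ) := {h | (∀ x, h x ∈ Set.Icc (0 : ℝ) 1) ∧ (∀ x ∈ A, h x = 1) ∧ ∀ x, h x ≤ R x}
  have hScl : IsClosed {h : V → ℝ | (∀ x ∈ A, h x = 1) ∧ ∀ x, h x ≤ R x} := by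
    have h1 : IsClosed (⋂ x ∈ A, {h : V → ℝ | h x = 1}) := isClosed_iInter fun x =>
      isClosed_iInter fun _ => isClosed_eq (continuous_apply x) continuous_const
    have h2 : IsClosed (⋂ x, {h : V → ℝ | h x ≤ R x}) := isClosed_iInter fun x =>
      isClosed_le (continuous_apply x) continuous_const
    convert h1.inter h2 using 1
    ext h
    simp
  have hSc : IsCompact S := by
    have h := (isCompact_univ_pi fun _ : V => isCompact_Icc (a := (0 : ℝ)) (b := 1)).inter_right hScl
    convert h using 1
    ext h
    simp only [S, Set.mem_inter_iff, Set.mem_univ_pi, Set.mem_ofPred_eq]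
  have hind : (A.indicator fun _ => (1 : ℝ)) ∈ S := by
    refine ⟨fun x => ?_, fun x hx => by simp [hx], hR _ hA le_rfl⟩
    by_cases hx : x ∈ A <;> simp [hx]
  obtain ⟨u, huS, hmin⟩ := LowerSemicontinuousOn.exists_isMinOn ⟨_, hind⟩ hSc
    ((lowerSemicontinuous_energy c).lowerSemicontinuousOn S)
  obtain ⟨hu01, huA, huR⟩ := huS
  have huE : energy c u ≤ energy c (A.indicator fun _ => (1 : ℝ)) := hmin hind
  refine ⟨u, fun x => (hu01 x).1, fun x => (hu01 x).2, huA, huR, fun x => ?_⟩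
  have hcu : Summable fun y => c x y * u y := Summable.of_nonneg_of_le
    (fun y => mul_nonneg (nonneg _ _) (hu01 y).1)
    (fun y => mul_le_of_le_one_right (nonneg _ _) (hu01 y).2) (hs x)
  have hcu1 : ∑' y, c x y * u y ≤ ∑' y, c x y :=
    hcu.tsum_le_tsum (fun y => mul_le_of_le_one_right (nonneg _ _) (hu01 y).2) (hs x)
  by_cases hxA : x ∈ A
  · rw [huA x hxA, mul_one]
    exact hcu1
  by_contra! hlt
  -- Raising `u x` to the average over the neighbours keeps all constraints and lowers the energy.
  have hm0 : 0 ≤ ∑' y, c x y := tsum_nonneg (nonneg x)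
  have hm : 0 < ∑' y, c x y := lt_of_le_of_ne hm0 fun h0 => by
    rw [← h0] at hlt hcu1
    linarith
  set m := ∑' y, c x y
  set t := (∑' y, c x y * u y) / m with ht
  have hmt : m * t = ∑' y, c x y * u y := mul_div_cancel₀ _ hm.ne'
  have hut : u x < t := by
    rw [← hmt] at hlt
    exact lt_of_mul_lt_mul_left hlt hm0
  have ht1 : t ≤ 1 := by
    rw [ht, div_le_one hm]
    exact hcu1
  have hsum : Summable fun p : V × V => c p.1 p.2 * (u p.1 - u p.2) ^ 2 := by
    have h := ENNReal.summable_toReal (ne_top_of_le_ne_top hAE huE)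
    refine h.congr fun p => ENNReal.toReal_ofReal (mul_nonneg (nonneg _ _) (sq_nonneg _))
  have hupd := hasSum_energy_update symm diag (hs x).hasSum (hmt ▸ hcu.hasSum) hsum.hasSum
  have hEu : energy c u = ENNReal.ofReal (∑' p : V × V, c p.1 p.2 * (u p.1 - u p.2) ^ 2) :=
    (ENNReal.ofReal_tsum_of_nonneg (fun p => mul_nonneg (nonneg _ _) (sq_nonneg _)) hsum).symm
  have hEh : energy c (Function.update u x t) = ENNReal.ofReal
      (∑' p : V × V, c p.1 p.2 * (u p.1 - u p.2) ^ 2 - 2 * (m * (t - u x) ^ 2)) := by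
    rw [← hupd.tsum_eq]
    exact (ENNReal.ofReal_tsum_of_nonneg (fun p => mul_nonneg (nonneg _ _) (sq_nonneg _))
      hupd.summable).symm
  have hpos : 0 < 2 * (m * (t - u x) ^ 2) := by
    have := sub_pos.2 hut
    positivity
  have hu0 : Tendsto u F (𝓝 0) := squeeze_zero (fun y => (hu01 y).1) huR hR0
  have hh0 : Tendsto (Function.update u x t) F (𝓝 0) := by
    refine hu0.congr' ?_
    have : ({x}ᶜ : Set V) ∈ F := hF (Set.finite_singleton x).compl_mem_cofinite
    filter_upwards [this] with y hy
    exact (Function.update_of_ne hy _ _).symm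
  have hle : energy c (Function.update u x t) ≤ energy c u := by
    rw [hEu, hEh]
    exact ENNReal.ofReal_le_ofReal (by linarith)
  have hmem : Function.update u x t ∈ S := by
    refine ⟨fun y => ?_, fun y hy => ?_, hR _ hh0 (hle.trans huE)⟩
    · by_cases hy : y = x
      · subst hy
        simpa using ⟨(hu01 y).1.trans hut.le, ht1⟩
      · simpa [hy] using hu01 y
    · have : y ≠ x := fun h => hxA (h ▸ hy)
      simpa [this] using huA y hy
  have hge : energy c u ≤ energy c (Function.update u x t) := hmin hmem
  rw [hEu, hEh] at hge
  have hnn : 0 ≤ ∑' p : V × V, c p.1 p.2 * (u p.1 - u p.2) ^ 2 - 2 * (m * (t - u x) ^ 2) :=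
    hupd.nonneg fun p => mul_nonneg (nonneg _ _) (sq_nonneg _)
  rw [ENNReal.ofReal_le_ofReal_iff hnn] at hge
  linarith

end Energy

/-! ### Geometry of the spider graph -/

section Geometry

variable {N : ℕ}

theorem exists_update_of_sum_abs_eq_one {x y : Fin N → ℤ} (h : ∑ i, |x i - y i| = 1) :
    ∃ i, y = Function.update x i (x i + 1) ∨ y = Function.update x i (x i - 1) := by
  have hex : ∃ i, x i ≠ y i := by
    by_contra! hc
    simp [hc] at h
  obtain ⟨i, hi⟩ := hex
  have h1 : ∑ j ∈ Finset.univ.erase i, |x j - y j| = 1 - |x i - y i| := by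
    rw [← h, ← Finset.add_sum_erase _ (fun j => |x j - y j|) (Finset.mem_univ i)]
    ring
  have h2 : 0 ≤ ∑ j ∈ Finset.univ.erase i, |x j - y j| := Finset.sum_nonneg fun j _ => abs_nonneg _
  have h3 : 0 < |x i - y i| := abs_pos.2 (sub_ne_zero.2 hi)
  have h4 : |x i - y i| = 1 := by omega
  rw [h4, sub_self, Finset.sum_eq_zero_iff_of_nonneg fun j _ => abs_nonneg _] at h1
  have h5 : ∀ j, j ≠ i → y j = x j := fun j hj => by
    have := h1 j (by simp [hj])
    rw [abs_eq_zero] at this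
    omega
  refine ⟨i, ?_⟩
  rcases (abs_eq zero_le_one).1 h4 with h6 | h6
  · refine Or.inr (funext fun j => ?_)
    by_cases hj : j = i
    · subst hj
      simp
      omega
    · simp [hj, h5]
  · refine Or.inl (funext fun j => ?_)
    by_cases hj : j = i
    · subst hj
      simp
      omega
    · simp [hj, h5]

theorem rate_update_add_one (s : ℤ) (ω : Env) (x : Fin N → ℤ) (i : Fin N) :
    rate s ω x (Function.update x i (x i + 1)) = wPlus s ω (x i) := by
  have h1 : ∑ j, |x j - Function.update x i (x i + 1) j| = 1 := by
    rw [Finset.sum_eq_single i] <;> simp +contextual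
  rw [rate, if_pos h1, Finset.sum_eq_single i]
  · simp
  · intro j _ hj
    simp only [Function.update_of_ne hj]
    rw [if_neg (by omega), if_neg (by omega)]
  · simp

theorem rate_update_sub_one (s : ℤ) (ω : Env) (x : Fin N → ℤ) (i : Fin N) :
    rate s ω x (Function.update x i (x i - 1)) = wMinus ω (x i) := by
  have h1 : ∑ j, |x j - Function.update x i (x i - 1) j| = 1 := by
    rw [Finset.sum_eq_single i] <;> simp +contextual
  rw [rate, if_pos h1, Finset.sum_eq_single i]
  · simp only [Function.update_self, if_true]
    rw [if_neg (by omega)]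
  · intro j _ hj
    simp only [Function.update_of_ne hj]
    rw [if_neg (by omega), if_neg (by omega)]
  · simp

theorem rate_of_sum_abs_ne_one (s : ℤ) (ω : Env) {x y : Fin N → ℤ} (h : ∑ i, |x i - y i| ≠ 1) :
    rate s ω x y = 0 := if_neg h

theorem rate_nonneg (s : ℤ) (ω : Env) (x y : Fin N → ℤ) : 0 ≤ rate s ω x y := by
  by_cases h : ∑ i, |x i - y i| = 1
  · exact ((rate_pos_iff s ω x y).2 h).le
  · exact (rate_of_sum_abs_ne_one s ω h).ge

theorem rate_mem_Icc {s : ℤ} {ω : Env} {δ : ℝ} (hω : ∀ z, δ ≤ ω z ∧ (ω z : ℝ) ≤ 1 - δ)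
    {x y : Fin N → ℤ} (h : ∑ i, |x i - y i| = 1) : rate s ω x y ∈ Set.Icc δ 1 := by
  obtain ⟨i, rfl | rfl⟩ := exists_update_of_sum_abs_eq_one h
  · rw [rate_update_add_one]
    exact ⟨(hω _).1, (ω (x i + s)).2.2.le⟩
  · rw [rate_update_sub_one, wMinus]
    exact ⟨by linarith [(hω (x i)).2], by linarith [(ω (x i)).2.1]⟩

theorem abs_sub_le_one_of_sum_abs_eq_one {x y : Fin N → ℤ} (h : ∑ i, |x i - y i| = 1) (i : Fin N) :
    |x i - y i| ≤ 1 := by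
  rw [← h]
  exact Finset.single_le_sum (f := fun i => |x i - y i|) (fun j _ => abs_nonneg _) (Finset.mem_univ i)

variable [NeZero N] {L : Finset (Fin N → ℤ)}

theorem mem_localConf_iff (x : Vert L) (z : ℤ) : x.1 ∈ localConf L z ↔ x.1 0 = z := by
  obtain ⟨x, w, hw⟩ := x
  constructor
  · exact fun h => h.1
  · rintro rfl
    obtain ⟨rfl, h⟩ := hw
    exact ⟨rfl, h⟩

/-- The translate of a configuration by `z`. -/
def shift (z : ℤ) (x : Vert L) : Vert L :=
  ⟨fun i => x.1 i + z, x.1 0 + z, rfl, by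
    have h := ((mem_localConf_iff x (x.1 0)).2 rfl).2
    convert h using 2
    ring⟩

@[simp] theorem shift_apply (z : ℤ) (x : Vert L) (i : Fin N) : (shift z x).1 i = x.1 i + z := rfl

theorem shift_shift_neg (z : ℤ) (x : Vert L) : shift z (shift (-z) x) = x := by
  apply Subtype.ext
  funext i
  simp

variable (L) in
theorem finite_level (z : ℤ) : {x : Vert L | x.1 0 = z}.Finite := by
  refine Set.Finite.of_finite_image (f := fun x : Vert L => fun i => x.1 i - z)
    (L.finite_toSet.subset ?_) ?_
  · rintro _ ⟨x, hx, rfl⟩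
    exact ((mem_localConf_iff x z).2 hx).2
  · intro x _ y _ hxy
    apply Subtype.ext
    funext i
    have := congrFun hxy i
    simpa using this

/-- If the local configurations form a connected graph and there is an edge from each local
configuration to the next one, then a function whose variation along the edges leaving level `z`
within levels `z` and `z + 1` is at most `ε` varies by at most `K ε` from any vertex of level `z` to
a fixed vertex of level `z + 1`. By translation invariance `K` does not depend on `z`. -/
theorem exists_variation_bound {s : ℤ} {ω : Env}
    (hi : ((spiderGraph s L ω).induce {u | u.1 ∈ localConf L 0}).Connected)
    (hii : ∃ u v : Vert L, u.1 ∈ localConf L 0 ∧ v.1 ∈ localConf L 1 ∧ (spiderGraph s L ω).Adj u v) :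
    ∃ (K : ℕ) (w : ℤ → Vert L), (∀ z, (w z).1 0 = z) ∧ ∀ (z : ℤ) (h : Vert L → ℝ) (ε : ℝ), 0 ≤ ε →
      (∀ x y : Vert L, x.1 0 = z → (y.1 0 = z ∨ y.1 0 = z + 1) → ∑ i, |x.1 i - y.1 i| = 1 →
        |h x - h y| ≤ ε) → ∀ x : Vert L, x.1 0 = z → |h x - h (w (z + 1))| ≤ K * ε := by
  obtain ⟨u, v, hu, hv, huv⟩ := hii
  have hfin : Finite ↥{u : Vert L | u.1 ∈ localConf L 0} := by
    refine ((finite_level L 0).subset fun x hx => ?_).to_subtype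
    exact (mem_localConf_iff x 0).1 hx
  set G := (spiderGraph s L ω).induce {u | u.1 ∈ localConf L 0} with hG
  obtain ⟨K, hK⟩ := (Set.finite_range fun p : ↥{u : Vert L | u.1 ∈ localConf L 0} ×
    ↥{u : Vert L | u.1 ∈ localConf L 0} => G.dist p.1 p.2).bddAbove
  have huv1 : ∑ i, |u.1 i - v.1 i| = 1 := (rate_pos_iff s ω u.1 v.1).1 huv
  rw [mem_localConf_iff] at hu hv
  refine ⟨K + 1, fun z => shift (z - 1) v, fun z => by simp [hv], fun z h ε hε hvar x hx => ?_⟩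
  have hwalk : ∀ (a b : ↥{u : Vert L | u.1 ∈ localConf L 0}) (p : G.Walk a b),
      |h (shift z a) - h (shift z b)| ≤ p.length * ε := by
    intro a b p
    induction p with
    | nil => simp
    | @cons a b c hab p ih =>
      have h1 : |h (shift z a) - h (shift z b)| ≤ ε := by
        refine hvar _ _ ?_ (Or.inl ?_) ?_
        · simp [(mem_localConf_iff a.1 0).1 a.2]
        · simp [(mem_localConf_iff b.1 0).1 b.2]
        · simpa using (rate_pos_iff s ω a.1.1 b.1.1).1 hab
      have h2 := abs_sub_le (h (shift z a)) (h (shift z b)) (h (shift z c))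
      rw [SimpleGraph.Walk.length_cons]
      push_cast
      linarith
  have hx0 : shift (-z) x ∈ {u : Vert L | u.1 ∈ localConf L 0} :=
    (mem_localConf_iff _ 0).2 (by simp [hx])
  have hu0 : u ∈ {u : Vert L | u.1 ∈ localConf L 0} := (mem_localConf_iff _ 0).2 hu
  obtain ⟨p, hp⟩ := (hi.preconnected ⟨_, hx0⟩ ⟨u, hu0⟩).exists_walk_length_eq_dist
  have h1 := hwalk _ _ p
  rw [shift_shift_neg] at h1
  have hlen : (p.length : ℝ) ≤ K := by
    rw [hp]
    exact_mod_cast hK ⟨(⟨_, hx0⟩, ⟨u, hu0⟩), rfl⟩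
  have h2 : |h (shift z u) - h (shift z v)| ≤ ε := by
    refine hvar _ _ ?_ (Or.inr ?_) ?_
    · simp [hu]
    · simp [hv, add_comm]
    · simpa using huv1
  have h3 := abs_sub_le (h x) (h (shift z u)) (h (shift z v))
  have h4 := mul_le_mul_of_nonneg_right hlen hε
  have h5 : z + 1 - 1 = z := add_sub_cancel_right z 1
  simp only [h5]
  push_cast
  linarith

/-- Irreducibility: a property that passes along the edges of the spider graph holds everywhere as
soon as it holds somewhere. -/
theorem forall_of_adj {s : ℤ} {ω : Env}
    (hi : ((spiderGraph s L ω).induce {u | u.1 ∈ localConf L 0}).Connected)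
    (hii : ∃ u v : Vert L, u.1 ∈ localConf L 0 ∧ v.1 ∈ localConf L 1 ∧ (spiderGraph s L ω).Adj u v)
    {Q : Vert L → Prop} (hQ : ∀ x y : Vert L, ∑ i, |x.1 i - y.1 i| = 1 → Q x → Q y) {x : Vert L}
    (hx : Q x) (y : Vert L) : Q y := by
  classical
  obtain ⟨K, w, hw, hK⟩ := exists_variation_bound hi hii
  -- The indicator of `Q` does not vary along edges: the variation bound applies with `ε = 0`.
  set h : Vert L → ℝ := fun x => if Q x then 1 else 0 with hh
  have hadj : ∀ x y : Vert L, ∑ i, |x.1 i - y.1 i| = 1 → |h x - h y| ≤ 0 := fun x y hxy => by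
    have : Q x ↔ Q y := ⟨hQ x y hxy, hQ y x (by simpa only [abs_sub_comm] using hxy)⟩
    simp [hh, this]
  have hstep : ∀ x : Vert L, h x = h (w (x.1 0 + 1)) := fun x => by
    have := hK (x.1 0) h 0 le_rfl (fun a b _ _ hab => hadj a b hab) x rfl
    rw [mul_zero, abs_nonpos_iff, sub_eq_zero] at this
    exact this
  have hconst : ∀ z : ℤ, h (w z) = h (w 0) := fun z => by
    have h1 : ∀ z : ℤ, h (w z) = h (w (z + 1)) := fun z => by
      conv_lhs => rw [hstep, hw]
    induction z using Int.induction_on with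
    | zero => rfl
    | succ n ih => rw [← h1, ih]
    | pred n ih => rw [h1, sub_add_cancel, ih]
  have hxy : h x = h y := by
    rw [hstep x, hstep y, hconst (x.1 0 + 1), hconst (y.1 0 + 1)]
  by_contra hy
  simp [hh, hx, hy] at hxy

theorem exists_adj {s : ℤ} {ω : Env}
    (hi : ((spiderGraph s L ω).induce {u | u.1 ∈ localConf L 0}).Connected)
    (hii : ∃ u v : Vert L, u.1 ∈ localConf L 0 ∧ v.1 ∈ localConf L 1 ∧ (spiderGraph s L ω).Adj u v)
    (x : Vert L) : ∃ y : Vert L, ∑ i, |x.1 i - y.1 i| = 1 := by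
  obtain ⟨u, v, -, -, huv⟩ := id hii
  refine forall_of_adj hi hii (Q := fun x : Vert L => ∃ y : Vert L, ∑ i, |x.1 i - y.1 i| = 1)
    (fun a b hab _ => ⟨a, by simpa only [abs_sub_comm] using hab⟩)
    ⟨v, (rate_pos_iff s ω u.1 v.1).1 huv⟩ x

variable (L) in
/-- The legs of a spider stay within a bounded distance of the first leg. -/
theorem exists_span_bound : ∃ D : ℕ, ∀ (x : Vert L) (i : Fin N), |x.1 i - x.1 0| ≤ D := by
  refine ⟨∑ l ∈ L, ∑ i, (l i).natAbs, fun x i => ?_⟩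
  have h := ((mem_localConf_iff x (x.1 0)).2 rfl).2
  have h1 : (x.1 i - x.1 0).natAbs ≤ ∑ j, (x.1 j - x.1 0).natAbs :=
    Finset.single_le_sum (f := fun j => (x.1 j - x.1 0).natAbs) (fun _ _ => Nat.zero_le _)
      (Finset.mem_univ i)
  have h2 := Finset.single_le_sum (f := fun l : Fin N → ℤ => ∑ i, (l i).natAbs)
    (fun _ _ => Nat.zero_le _) h
  rw [Int.abs_eq_natAbs]
  exact_mod_cast h1.trans h2

end Geometry

/-! ### Conductances of the spider walk -/

section Conductance

/-- The reversible measure of a single leg, in terms of a potential `U` with increments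
`log (ω_x / (1 - ω_x))`. Only `s = 0` and `s = 1` matter: for `s = 1` the rates `ω_{x+1}` and
`1 - ω_{x+1}` across the edge `{x, x + 1}` balance `exp U` exactly, while for `s = 0` the rates `ω_x`
and `1 - ω_{x+1}` require the correction `1 / ω_x`. -/
def legWeight (s : ℤ) (ω : Env) (U : ℤ → ℝ) (x : ℤ) : ℝ :=
  Real.exp (U x) * if s = 1 then 1 else (ω x : ℝ)⁻¹

theorem legWeight_pos (s : ℤ) (ω : Env) (U : ℤ → ℝ) (x : ℤ) : 0 < legWeight s ω U x := by
  have := (ω x).2.1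
  unfold legWeight
  split_ifs <;> positivity

theorem exp_mul_one_sub {ω : Env} {U : ℤ → ℝ}
    (hU : ∀ z, U (z + 1) = U z + Real.log (ω (z + 1) / (1 - ω (z + 1)))) (z : ℤ) :
    Real.exp (U (z + 1)) * (1 - ω (z + 1)) = Real.exp (U z) * ω (z + 1) := by
  have h1 := (ω (z + 1)).2.1
  have h2 := sub_pos.2 (ω (z + 1)).2.2
  rw [hU, Real.exp_add, Real.exp_log (by positivity), mul_assoc, div_mul_cancel₀ _ h2.ne']

/-- Detailed balance for a single leg. -/
theorem legWeight_mul_wPlus {s : ℤ} (hs : s = 0 ∨ s = 1) {ω : Env} {U : ℤ → ℝ}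
    (hU : ∀ z, U (z + 1) = U z + Real.log (ω (z + 1) / (1 - ω (z + 1)))) (z : ℤ) :
    legWeight s ω U z * wPlus s ω z = legWeight s ω U (z + 1) * wMinus ω (z + 1) := by
  have h := exp_mul_one_sub hU z
  rcases hs with rfl | rfl
  · have h1 := (ω (z + 1)).2.1.ne'
    have h2 := (ω z).2.1.ne'
    simp only [legWeight, wPlus, wMinus, zero_ne_one, if_false, add_zero]
    field_simp
    linarith
  · simp [legWeight, wPlus, wMinus, h]

theorem legWeight_mem_Icc {s : ℤ} {ω : Env} {δ : ℝ} (hδ : 0 < δ) (hω : ∀ z, δ ≤ ω z) (U : ℤ → ℝ)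
    (x : ℤ) : legWeight s ω U x ∈ Set.Icc (Real.exp (U x)) (Real.exp (U x) * δ⁻¹) := by
  have h1 : (1 : ℝ) ≤ (ω x : ℝ)⁻¹ := (one_le_inv₀ (ω x).2.1).2 (ω x).2.2.le
  have h2 : (ω x : ℝ)⁻¹ ≤ δ⁻¹ := inv_anti₀ hδ (hω x)
  have h3 := Real.exp_pos (U x)
  unfold legWeight
  split_ifs
  · constructor <;> nlinarith
  · constructor <;> nlinarith

variable {N : ℕ}

/-- The conductance between two configurations: the product of the reversible measures of the legs
times the jump rate. -/
def conductance (s : ℤ) (ω : Env) (U : ℤ → ℝ) (x y : Fin N → ℤ) : ℝ :=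
  (∏ i, legWeight s ω U (x i)) * rate s ω x y

theorem prod_legWeight_pos (s : ℤ) (ω : Env) (U : ℤ → ℝ) (x : Fin N → ℤ) :
    0 < ∏ i, legWeight s ω U (x i) := Finset.prod_pos fun _ _ => legWeight_pos s ω U _

theorem conductance_nonneg (s : ℤ) (ω : Env) (U : ℤ → ℝ) (x y : Fin N → ℤ) :
    0 ≤ conductance s ω U x y := mul_nonneg (prod_legWeight_pos s ω U x).le (rate_nonneg s ω x y)

theorem conductance_self (s : ℤ) (ω : Env) (U : ℤ → ℝ) (x : Fin N → ℤ) :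
    conductance s ω U x x = 0 := by
  rw [conductance, rate_of_sum_abs_ne_one _ _ (by simp), mul_zero]

theorem conductance_update_add_one {s : ℤ} (hs : s = 0 ∨ s = 1) {ω : Env} {U : ℤ → ℝ}
    (hU : ∀ z, U (z + 1) = U z + Real.log (ω (z + 1) / (1 - ω (z + 1)))) (x : Fin N → ℤ) (i : Fin N) :
    conductance s ω U x (Function.update x i (x i + 1)) =
      conductance s ω U (Function.update x i (x i + 1)) x := by
  have h1 : x = Function.update (Function.update x i (x i + 1)) i
      (Function.update x i (x i + 1) i - 1) := by simp
  have h2 : ∏ j, legWeight s ω U (Function.update x i (x i + 1) j) =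
      legWeight s ω U (x i + 1) * ∏ j ∈ Finset.univ.erase i, legWeight s ω U (x j) := by
    rw [← Finset.mul_prod_erase _ _ (Finset.mem_univ i), Function.update_self]
    congr 1
    refine Finset.prod_congr rfl fun j hj => ?_
    rw [Function.update_of_ne (Finset.ne_of_mem_erase hj)]
  have h3 := rate_update_sub_one s ω (Function.update x i (x i + 1)) i
  rw [← h1, Function.update_self] at h3
  rw [conductance, conductance, h2, h3, rate_update_add_one, ← Finset.mul_prod_erase _ _ (Finset.mem_univ i)]
  linear_combination (∏ j ∈ Finset.univ.erase i, legWeight s ω U (x j)) *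
    legWeight_mul_wPlus hs hU (x i)

/-- The spider walk is reversible. -/
theorem conductance_comm {s : ℤ} (hs : s = 0 ∨ s = 1) {ω : Env} {U : ℤ → ℝ}
    (hU : ∀ z, U (z + 1) = U z + Real.log (ω (z + 1) / (1 - ω (z + 1)))) (x y : Fin N → ℤ) :
    conductance s ω U x y = conductance s ω U y x := by
  by_cases h : ∑ i, |x i - y i| = 1
  · obtain ⟨i, rfl | rfl⟩ := exists_update_of_sum_abs_eq_one h
    · exact conductance_update_add_one hs hU x i
    · have := conductance_update_add_one hs hU (Function.update x i (x i - 1)) i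
      simpa using this.symm
  · rw [conductance, conductance, rate_of_sum_abs_ne_one _ _ h, rate_of_sum_abs_ne_one, mul_zero,
      mul_zero]
    simpa only [abs_sub_comm] using h

theorem abs_sub_le_of_increments {U : ℤ → ℝ} {B : ℝ} (hB : ∀ z, |U (z + 1) - U z| ≤ B) (x y : ℤ) :
    |U x - U y| ≤ B * |x - y| := by
  have h : ∀ (n : ℕ) (z : ℤ), |U (z + n) - U z| ≤ B * n := by
    intro n z
    induction n with
    | zero => simp
    | succ n ih =>
      have h1 := hB (z + n)
      have h2 := abs_sub_le (U (z + n + 1)) (U (z + n)) (U z)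
      push_cast
      rw [← add_assoc]
      linarith
  rcases le_total x y with hxy | hxy
  · obtain ⟨n, rfl⟩ := Int.le.dest hxy
    rw [abs_sub_comm]
    simpa using h n x
  · obtain ⟨n, rfl⟩ := Int.le.dest hxy
    simpa using h n y

variable [NeZero N]

/-- In an elliptic environment, the conductances of the edges at level `z` are comparable to
`exp (N * U z)`. -/
theorem exists_conductance_bounds (L : Finset (Fin N → ℤ)) {s : ℤ} {ω : Env} {U : ℤ → ℝ} {δ B : ℝ}
    (hδ : 0 < δ) (hω : ∀ z, δ ≤ ω z ∧ (ω z : ℝ) ≤ 1 - δ) (hB : ∀ z, |U (z + 1) - U z| ≤ B) :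
    ∃ k₁ k₂ : ℝ, 0 < k₁ ∧ 0 < k₂ ∧ ∀ x y : Vert L, ∑ i, |x.1 i - y.1 i| = 1 →
      conductance s ω U x.1 y.1 ∈
        Set.Icc (k₁ * Real.exp (N * U (x.1 0))) (k₂ * Real.exp (N * U (x.1 0))) := by
  obtain ⟨D, hD⟩ := exists_span_bound L
  have hB0 : 0 ≤ B := (abs_nonneg _).trans (hB 0)
  have hUD : ∀ (x : Vert L) (i : Fin N), |U (x.1 i) - U (x.1 0)| ≤ B * D := fun x i =>
    (abs_sub_le_of_increments hB _ _).trans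
      (mul_le_mul_of_nonneg_left (by exact_mod_cast hD x i) hB0)
  refine ⟨Real.exp (-(B * D)) ^ N * δ, (Real.exp (B * D) * δ⁻¹) ^ N, by positivity, by positivity,
    fun x y hxy => ?_⟩
  obtain ⟨hr1, hr2⟩ := rate_mem_Icc (s := s) hω hxy
  have hw := fun i => legWeight_mem_Icc (s := s) hδ (fun z => (hω z).1) U (x.1 i)
  have hlow : (Real.exp (U (x.1 0)) * Real.exp (-(B * D))) ^ N ≤ ∏ i, legWeight s ω U (x.1 i) := by
    have : ∏ _i : Fin N, (Real.exp (U (x.1 0)) * Real.exp (-(B * D))) ≤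
        ∏ i, legWeight s ω U (x.1 i) := by
      refine Finset.prod_le_prod (fun _ _ => by positivity) fun i _ => le_trans ?_ (hw i).1
      rw [← Real.exp_add, Real.exp_le_exp]
      linarith [(abs_le.1 (hUD x i)).1]
    simpa using this
  have hup : ∏ i, legWeight s ω U (x.1 i) ≤
      (Real.exp (U (x.1 0)) * (Real.exp (B * D) * δ⁻¹)) ^ N := by
    have : ∏ i, legWeight s ω U (x.1 i) ≤
        ∏ _i : Fin N, (Real.exp (U (x.1 0)) * (Real.exp (B * D) * δ⁻¹)) := by
      refine Finset.prod_le_prod (fun i _ => (legWeight_pos _ _ _ _).le) fun i _ =>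
        (hw i).2.trans ?_
      rw [← mul_assoc, ← Real.exp_add]
      refine mul_le_mul_of_nonneg_right (Real.exp_le_exp.2 ?_) (by positivity)
      linarith [(abs_le.1 (hUD x i)).2]
    simpa using this
  rw [mul_pow] at hlow hup
  rw [Real.exp_nat_mul]
  unfold conductance
  have hp := prod_legWeight_pos s ω U x.1
  constructor
  · calc _ = Real.exp (U (x.1 0)) ^ N * Real.exp (-(B * D)) ^ N * δ := by ring
      _ ≤ _ := mul_le_mul hlow hr1 hδ.le hp.le
  · calc _ ≤ (∏ i, legWeight s ω U (x.1 i)) * 1 := mul_le_mul_of_nonneg_left hr2 hp.le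
      _ ≤ _ := by
        rw [mul_one, mul_comm (_ ^ N)]
        linarith

end Conductance

/-! ### Superharmonic functions for the spider -/

section Potential

variable {N : ℕ} [NeZero N] {L : Finset (Fin N → ℤ)}

theorem summable_rate (s : ℤ) (ω : Env) (x : Vert L) : Summable fun y : Vert L => rate s ω x.1 y.1 := by
  refine (ENNReal.summable_toReal (totalRate_ne_top s L ω x)).congr fun y => ?_
  exact ENNReal.toReal_ofReal (rate_nonneg s ω _ _)

theorem totalRate_eq_ofReal (s : ℤ) (ω : Env) (x : Vert L) :
    totalRate s L ω x = ENNReal.ofReal (∑' y : Vert L, rate s ω x.1 y.1) :=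
  (ENNReal.ofReal_tsum_of_nonneg (fun _ => rate_nonneg s ω _ _) (summable_rate s ω x)).symm

theorem totalRate_ne_zero {s : ℤ} {ω : Env} {x y : Vert L} (h : ∑ i, |x.1 i - y.1 i| = 1) :
    totalRate s L ω x ≠ 0 := by
  rw [totalRate, Ne, ENNReal.tsum_eq_zero, not_forall]
  refine ⟨y, ?_⟩
  rw [ENNReal.ofReal_eq_zero, not_le]
  exact (rate_pos_iff s ω _ _).2 h

theorem jumpPMF_apply {s : ℤ} {ω : Env} {x : Vert L} (h : totalRate s L ω x ≠ 0) (y : Vert L) :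
    jumpPMF s L ω x y = ENNReal.ofReal (rate s ω x.1 y.1) * (totalRate s L ω x)⁻¹ := by
  rw [jumpPMF, dif_neg h]
  rfl

theorem jumpPMF_ne_zero_iff {s : ℤ} {ω : Env} {x : Vert L} (h : totalRate s L ω x ≠ 0) (y : Vert L) :
    jumpPMF s L ω x y ≠ 0 ↔ ∑ i, |x.1 i - y.1 i| = 1 := by
  rw [jumpPMF_apply h, ← rate_pos_iff s ω, mul_ne_zero_iff, Ne, ENNReal.ofReal_eq_zero, not_le,
    and_iff_left (ENNReal.inv_ne_zero.2 (totalRate_ne_top s L ω x))]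

/-- A function that is superharmonic for the conductances is excessive for the jump chain. -/
theorem tsum_jumpPMF_mul_le {s : ℤ} {ω : Env} {U : ℤ → ℝ} {u : Vert L → ℝ} (h0 : ∀ x, 0 ≤ u x)
    (h1 : ∀ x, u x ≤ 1) {x : Vert L} (hx : totalRate s L ω x ≠ 0)
    (h : ∑' y : Vert L, conductance s ω U x.1 y.1 * u y ≤
      (∑' y : Vert L, conductance s ω U x.1 y.1) * u x) :
    ∑' y, jumpPMF s L ω x y * ENNReal.ofReal (u y) ≤ ENNReal.ofReal (u x) := by
  have hru : Summable fun y : Vert L => rate s ω x.1 y.1 * u y := Summable.of_nonneg_of_le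
    (fun y => mul_nonneg (rate_nonneg _ _ _ _) (h0 y))
    (fun y => mul_le_of_le_one_right (rate_nonneg _ _ _ _) (h1 y)) (summable_rate s ω x)
  simp only [conductance, mul_assoc, tsum_mul_left] at h
  have h2 := le_of_mul_le_mul_left h (prod_legWeight_pos s ω U x.1)
  have h3 : ∀ y, jumpPMF s L ω x y * ENNReal.ofReal (u y) =
      (totalRate s L ω x)⁻¹ * ENNReal.ofReal (rate s ω x.1 y.1 * u y) := fun y => by
    rw [jumpPMF_apply hx, ENNReal.ofReal_mul (rate_nonneg _ _ _ _)]
    ring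
  simp only [h3]
  rw [ENNReal.tsum_mul_left, ← ENNReal.ofReal_tsum_of_nonneg
    (fun y => mul_nonneg (rate_nonneg _ _ _ _) (h0 y)) hru]
  calc _ ≤ (totalRate s L ω x)⁻¹ * ENNReal.ofReal ((∑' y : Vert L, rate s ω x.1 y.1) * u x) := by
        gcongr
    _ = (totalRate s L ω x)⁻¹ * totalRate s L ω x * ENNReal.ofReal (u x) := by
        rw [ENNReal.ofReal_mul (tsum_nonneg fun y => rate_nonneg _ _ _ _), totalRate_eq_ofReal,
          mul_assoc]
    _ = ENNReal.ofReal (u x) := by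
        rw [ENNReal.inv_mul_cancel hx (totalRate_ne_top s L ω x), one_mul]

variable (L) in
/-- Escape of the first leg to the right. -/
def toRight : Filter (Vert L) := comap (fun x => x.1 0) atTop

theorem toRight_le_cofinite : toRight L ≤ cofinite := by
  rw [le_cofinite_iff_compl_singleton_mem]
  intro x
  refine mem_comap.2 ⟨Set.Ioi (x.1 0), Ioi_mem_atTop _, fun y hy hyx => ?_⟩
  obtain rfl : y = x := hyx
  exact lt_irrefl (y.1 0) hy

theorem tendsto_indicator_toRight (a : ℤ) :
    Tendsto ({x : Vert L | x.1 0 ≤ a}.indicator fun _ => (1 : ℝ)) (toRight L) (𝓝 0) := by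
  refine tendsto_const_nhds.congr' ?_
  have : ∀ᶠ x in toRight L, a < x.1 0 := (eventually_gt_atTop a).comap _
  filter_upwards [this] with x hx
  simp [hx]

/-- The energy of the indicator of the levels up to `a` is carried by the edges between the levels
`a` and `a + 1`, whose number does not depend on `a`. -/
theorem exists_energy_indicator_le {s : ℤ} (hs : s = 0 ∨ s = 1) {ω : Env} {U : ℤ → ℝ}
    (hU : ∀ z, U (z + 1) = U z + Real.log (ω (z + 1) / (1 - ω (z + 1)))) {k : ℝ} (hk : 0 < k)
    (hc : ∀ x y : Vert L, ∑ i, |x.1 i - y.1 i| = 1 →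
      conductance s ω U x.1 y.1 ≤ k * Real.exp (N * U (x.1 0))) :
    ∃ M : ℝ, 0 ≤ M ∧ ∀ a : ℤ, energy (fun x y : Vert L => conductance s ω U x.1 y.1)
      ({x : Vert L | x.1 0 ≤ a}.indicator fun _ => (1 : ℝ)) ≤
        ENNReal.ofReal (M * Real.exp (N * U a)) := by
  classical
  set T₀ : Finset (Vert L) := (finite_level L 0).toFinset ∪ (finite_level L 1).toFinset with hT₀
  set T : ℤ → Finset (Vert L) := fun a => T₀.image (shift a) with hT
  have hmemT : ∀ (a : ℤ) (x : Vert L), x.1 0 = a ∨ x.1 0 = a + 1 → x ∈ T a := by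
    intro a x hx
    refine Finset.mem_image.2 ⟨shift (-a) x, ?_, shift_shift_neg a x⟩
    simp only [hT₀, Finset.mem_union, Set.Finite.mem_toFinset, Set.mem_ofPred_eq, shift_apply]
    omega
  have hcard : ∀ a, (T a ×ˢ T a).card ≤ T₀.card ^ 2 := fun a => by
    rw [Finset.card_product, sq]
    exact Nat.mul_le_mul Finset.card_image_le Finset.card_image_le
  refine ⟨T₀.card ^ 2 * k, by positivity, fun a => ?_⟩
  set h : Vert L → ℝ := {x : Vert L | x.1 0 ≤ a}.indicator fun _ => (1 : ℝ) with hh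
  have key : ∀ x y : Vert L, (¬ (x ∈ T a ∧ y ∈ T a) →
      conductance s ω U x.1 y.1 * (h x - h y) ^ 2 = 0) ∧
      conductance s ω U x.1 y.1 * (h x - h y) ^ 2 ≤ k * Real.exp (N * U a) := by
    intro x y
    by_cases hxy : ∑ i, |x.1 i - y.1 i| = 1
    · have h1 := abs_le.1 (abs_sub_le_one_of_sum_abs_eq_one hxy 0)
      by_cases hx : x.1 0 ≤ a <;> by_cases hy : y.1 0 ≤ a
      · simp only [hh, Set.indicator, Set.mem_ofPred_eq, hx, hy, if_true, sub_self]
        simp only [ne_eq, OfNat.ofNat_ne_zero, not_false_eq_true, zero_pow, mul_zero, implies_true,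
          true_and]
        positivity
      · refine ⟨fun hn => absurd ⟨hmemT a x (by omega), hmemT a y (by omega)⟩ hn, ?_⟩
        have h2 := hc x y hxy
        rw [show x.1 0 = a by omega] at h2
        simpa [hh, Set.indicator, hx, hy] using h2
      · refine ⟨fun hn => absurd ⟨hmemT a x (by omega), hmemT a y (by omega)⟩ hn, ?_⟩
        have h2 := hc y x (by simpa only [abs_sub_comm] using hxy)
        rw [show y.1 0 = a by omega, conductance_comm hs hU] at h2
        simpa [hh, Set.indicator, hx, hy] using h2
      · simp only [hh, Set.indicator, Set.mem_ofPred_eq, hx, hy, if_false, sub_self]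
        simp only [ne_eq, OfNat.ofNat_ne_zero, not_false_eq_true, zero_pow, mul_zero, implies_true,
          true_and]
        positivity
    · rw [conductance, rate_of_sum_abs_ne_one _ _ hxy, mul_zero, zero_mul]
      exact ⟨fun _ => rfl, by positivity⟩
  rw [energy, tsum_eq_sum (s := T a ×ˢ T a)]
  · refine (Finset.sum_le_card_nsmul _ _ _ fun p _ =>
      ENNReal.ofReal_le_ofReal (key p.1 p.2).2).trans ?_
    rw [nsmul_eq_mul, mul_assoc, ENNReal.ofReal_mul (p := (T₀.card : ℝ) ^ 2) (by positivity)]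
    refine mul_le_mul' ?_ le_rfl
    rw [← Nat.cast_pow, ENNReal.ofReal_natCast]
    exact_mod_cast hcard a
  · intro p hp
    rw [(key p.1 p.2).1 (by simpa using hp), ENNReal.ofReal_zero]

theorem summable_int_add_nat {r : ℤ → ℝ} (hr : Summable fun k : ℕ => r k) (z : ℤ) :
    Summable fun k : ℕ => r (z + k) := by
  obtain ⟨n, rfl | rfl⟩ := z.eq_nat_or_neg
  · have := (summable_nat_add_iff n).2 hr
    refine this.congr fun k => ?_
    push_cast
    rw [add_comm]
  · rw [← summable_nat_add_iff n]
    refine hr.congr fun k => ?_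
    push_cast
    congr 1
    ring

theorem tendsto_tsum_int_add_nat (r : ℤ → ℝ) :
    Tendsto (fun z : ℤ => ∑' k : ℕ, r (z + k)) atTop (𝓝 0) := by
  have h1 : Tendsto Int.toNat atTop atTop :=
    tendsto_atTop.2 fun n => (eventually_ge_atTop (n : ℤ)).mono fun z hz => by omega
  refine ((tendsto_sum_nat_add fun k : ℕ => r k).comp h1).congr' ?_
  filter_upwards [eventually_ge_atTop 0] with z hz
  refine tsum_congr fun k => ?_
  push_cast
  rw [Int.toNat_of_nonneg hz, add_comm]

/-- A function of finite energy that vanishes to the right is bounded by a tail of the series of the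
square roots of the resistances. -/
theorem le_of_energy_le {c : Vert L → Vert L → ℝ} {k : ℝ} (hk : 0 < k) {U : ℤ → ℝ}
    (hc : ∀ x y : Vert L, ∑ i, |x.1 i - y.1 i| = 1 → k * Real.exp (N * U (x.1 0)) ≤ c x y)
    (hUs : Summable fun n : ℕ => Real.exp (-(N * U n / 2))) {K : ℕ} {w : ℤ → Vert L}
    (hw : ∀ z, (w z).1 0 = z)
    (hK : ∀ (z : ℤ) (h : Vert L → ℝ) (ε : ℝ), 0 ≤ ε →
      (∀ x y : Vert L, x.1 0 = z → (y.1 0 = z ∨ y.1 0 = z + 1) → ∑ i, |x.1 i - y.1 i| = 1 →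
        |h x - h y| ≤ ε) → ∀ x : Vert L, x.1 0 = z → |h x - h (w (z + 1))| ≤ K * ε)
    {E : ℝ} (hE : 0 ≤ E) {h : Vert L → ℝ} (h0 : Tendsto h (toRight L) (𝓝 0))
    (hle : energy c h ≤ ENNReal.ofReal E) (x : Vert L) :
    h x ≤ K * √(E / k) * ∑' j : ℕ, Real.exp (-(N * U (x.1 0 + j) / 2)) := by
  set r : ℤ → ℝ := fun z => Real.exp (-(N * U z / 2)) with hr
  have hvar : ∀ x y : Vert L, ∑ i, |x.1 i - y.1 i| = 1 → |h x - h y| ≤ √(E / k) * r (x.1 0) := by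
    intro x y hxy
    have h1 := conductance_mul_sq_le_energy hE hle x y
    have h2 := mul_le_mul_of_nonneg_right (hc x y hxy) (sq_nonneg (h x - h y))
    have h3 : r (x.1 0) ^ 2 * Real.exp (N * U (x.1 0)) = 1 := by
      rw [hr, ← Real.exp_nat_mul, ← Real.exp_add, Real.exp_eq_one_iff]
      push_cast
      ring
    refine abs_le_of_sq_le_sq ?_ (by positivity)
    rw [mul_pow, Real.sq_sqrt (by positivity), div_mul_eq_mul_div, le_div_iff₀ hk]
    have h4 : 0 ≤ r (x.1 0) ^ 2 := sq_nonneg _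
    calc (h x - h y) ^ 2 * k
        = r (x.1 0) ^ 2 * Real.exp (N * U (x.1 0)) * ((h x - h y) ^ 2 * k) := by rw [h3, one_mul]
      _ = r (x.1 0) ^ 2 * (k * Real.exp (N * U (x.1 0)) * (h x - h y) ^ 2) := by ring
      _ ≤ r (x.1 0) ^ 2 * E := mul_le_mul_of_nonneg_left (h2.trans h1) h4
      _ = E * r (x.1 0) ^ 2 := mul_comm _ _
  have hstep : ∀ x : Vert L, h x ≤ h (w (x.1 0 + 1)) + K * √(E / k) * r (x.1 0) := by
    intro x
    have h1 := hK (x.1 0) h (√(E / k) * r (x.1 0)) (by positivity)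
      (fun a b ha _ hab => ha ▸ hvar a b hab) x rfl
    have := (abs_le.1 h1).2
    rw [← mul_assoc] at this
    linarith
  have hn : ∀ n : ℕ, h x ≤ h (w (x.1 0 + n + 1)) +
      K * √(E / k) * ∑ j ∈ Finset.range (n + 1), r (x.1 0 + j) := by
    intro n
    induction n with
    | zero => simpa using hstep x
    | succ n ih =>
      have h1 := hstep (w (x.1 0 + n + 1))
      rw [hw] at h1
      rw [Finset.sum_range_succ, mul_add]
      push_cast
      simp only [← add_assoc]
      linarith
  have hlim1 : Tendsto (fun n : ℕ => h (w (x.1 0 + n + 1))) atTop (𝓝 0) := by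
    refine h0.comp (tendsto_comap_iff.2 ?_)
    simp only [Function.comp_def, hw]
    exact tendsto_atTop_add_const_right _ _
      (tendsto_atTop_add_const_left _ _ tendsto_natCast_atTop_atTop)
  have hlim2 := ((summable_int_add_nat (r := r) hUs (x.1 0)).hasSum.tendsto_sum_nat.comp
    (tendsto_add_atTop_nat 1)).const_mul (K * √(E / k))
  have hlim := hlim1.add hlim2
  rw [zero_add] at hlim
  exact ge_of_tendsto' hlim hn

/-- If the potential increases fast enough to the right and tends to `-∞` to the left, there are
excessive functions of the jump chain that are equal to `1` far to the left, vanish to the right, and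
are arbitrarily small at a given configuration `x`. -/
theorem exists_excessive {s : ℤ} (hs : s = 0 ∨ s = 1) {ω : Env}
    (hi : ((spiderGraph s L ω).induce {u | u.1 ∈ localConf L 0}).Connected)
    (hii : ∃ u v : Vert L, u.1 ∈ localConf L 0 ∧ v.1 ∈ localConf L 1 ∧ (spiderGraph s L ω).Adj u v)
    {U : ℤ → ℝ} (hU : ∀ z, U (z + 1) = U z + Real.log (ω (z + 1) / (1 - ω (z + 1)))) {δ B : ℝ}
    (hδ : 0 < δ) (hω : ∀ z, δ ≤ ω z ∧ (ω z : ℝ) ≤ 1 - δ) (hB : ∀ z, |U (z + 1) - U z| ≤ B)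
    (hUs : Summable fun n : ℕ => Real.exp (-(N * U n / 2))) (hUbot : Tendsto U atBot atBot)
    (x : Vert L) {ε : ℝ} (hε : 0 < ε) :
    ∃ (a : ℤ) (u : Vert L → ℝ≥0∞), (∀ y, u y ≤ 1) ∧ (∀ y : Vert L, y.1 0 ≤ a → u y = 1) ∧
      u x ≤ ENNReal.ofReal ε ∧ Tendsto u (toRight L) (𝓝 0) ∧
      ∀ y, ∑' y', jumpPMF s L ω y y' * u y' ≤ u y := by
  obtain ⟨k₁, k₂, hk₁, hk₂, hc⟩ := exists_conductance_bounds L (s := s) hδ hω hB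
  obtain ⟨K, w, hw, hK⟩ := exists_variation_bound hi hii
  obtain ⟨M, hM, hEM⟩ := exists_energy_indicator_le hs hU hk₂ fun x y hxy => (hc x y hxy).2
  set ρ : ℤ → ℝ := fun z => ∑' j : ℕ, Real.exp (-(N * U (z + j) / 2)) with hρ
  set b : ℤ → ℝ := fun a => K * √(M * Real.exp (N * U a) / k₁) with hb
  have hN : (0 : ℝ) < N := by exact_mod_cast Nat.pos_of_ne_zero (NeZero.ne N)
  have hblim : Tendsto (fun a => b a * ρ (x.1 0)) atBot (𝓝 0) := by
    have h1 : Tendsto (fun a => Real.exp (N * U a)) atBot (𝓝 0) :=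
      Real.tendsto_exp_atBot.comp (hUbot.const_mul_atBot hN)
    have h2 := ((((h1.const_mul M).div_const k₁).sqrt).const_mul (K : ℝ)).mul_const (ρ (x.1 0))
    simpa using h2
  obtain ⟨a, ha⟩ := (hblim.eventually_le_const hε).exists
  have hρ0 : Tendsto (fun y : Vert L => b a * ρ (y.1 0)) (toRight L) (𝓝 0) := by
    have h1 : Tendsto ρ atTop (𝓝 0) :=
      tendsto_tsum_int_add_nat fun z => Real.exp (-(N * U z / 2))
    have h2 := (h1.comp (tendsto_comap (f := fun x : Vert L => x.1 0))).const_mul (b a)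
    rw [mul_zero] at h2
    exact h2
  obtain ⟨u, hu0, hu1, huA, huR, husup⟩ := exists_superharmonic
    (c := fun x y : Vert L => conductance s ω U x.1 y.1) (fun _ _ => conductance_nonneg _ _ _ _ _)
    (fun _ _ => conductance_comm hs hU _ _) (fun _ => conductance_self _ _ _ _)
    (fun y => (summable_rate s ω y).mul_left _) toRight_le_cofinite (tendsto_indicator_toRight a)
    (ne_top_of_le_ne_top ENNReal.ofReal_ne_top (hEM a)) hρ0 fun h h0 hle y =>
      le_of_energy_le hk₁ (fun x y hxy => (hc x y hxy).1) hUs hw hK (by positivity) h0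
        (hle.trans (hEM a)) y
  refine ⟨a, fun y => ENNReal.ofReal (u y), fun y => ENNReal.ofReal_le_one.2 (hu1 y),
    fun y hy => by simp [huA y hy], ENNReal.ofReal_le_ofReal ((huR x).trans ha), ?_, fun y => ?_⟩
  · have h1 : Tendsto u (toRight L) (𝓝 0) := squeeze_zero hu0 huR hρ0
    simpa using ENNReal.tendsto_ofReal h1
  · obtain ⟨y', hy'⟩ := exists_adj hi hii y
    exact tsum_jumpPMF_mul_le hu0 hu1 (totalRate_ne_zero hy') (husup y)

end Potential

/-! ### Transience of the jump chain -/

section Chain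

variable {N : ℕ} [NeZero N] {L : Finset (Fin N → ℤ)}

theorem measurableSet_eval_eq (n : ℕ) (y : Vert L) : MeasurableSet {f : ℕ → Vert L | f n = y} :=
  measurableSet_eq_fun (measurable_pi_apply n) measurable_const

theorem measurable_eval_of_countable {β : Type*} [MeasurableSpace β] (v : Vert L → β) (n : ℕ) :
    Measurable fun f : ℕ → Vert L => v (f n) :=
  (measurable_of_countable v).comp (measurable_pi_apply n)

/-- One step of the jump chain. -/
theorem lintegral_chainLaw_succ (s : ℤ) (ω : Env) (x : Vert L) (n : ℕ)
    (g : Vert L → Vert L → ℝ≥0∞) :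
    ∫⁻ f, g (f n) (f (n + 1)) ∂chainLaw s L ω x =
      ∫⁻ f, ∑' y, jumpPMF s L ω (f n) y * g (f n) y ∂chainLaw s L ω x := by
  have hm := Kernel.map_frestrictLe_trajMeasure_compProd_eq_map_trajMeasure
    (X := fun _ => Vert L) (μ₀ := Measure.dirac x) (κ := jumpKernel s L ω) (a := n)
  have hg : Measurable fun q : Vert L × Vert L => g q.1 q.2 := measurable_of_countable _
  let e : ((i : Finset.Iic n) → (fun _ : ℕ => Vert L) i) × Vert L → Vert L × Vert L :=
    fun p => (p.1 ⟨n, Finset.mem_Iic.2 le_rfl⟩, p.2)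
  have he : Measurable e :=
    ((measurable_pi_apply _).comp measurable_fst).prodMk measurable_snd
  have hG : Measurable fun p => g (e p).1 (e p).2 := hg.comp he
  have h1 : ∫⁻ f, g (f n) (f (n + 1)) ∂chainLaw s L ω x =
      ∫⁻ p, g (e p).1 (e p).2 ∂((chainLaw s L ω x).map
        fun f => (Preorder.frestrictLe (π := fun _ => Vert L) n f, f (n + 1))) := by
    rw [lintegral_map hG (Measurable.prodMk (by fun_prop) (by fun_prop))]
    rfl
  rw [h1, chainLaw, ← hm, Measure.lintegral_compProd hG, ← chainLaw,
    lintegral_map (Measurable.lintegral_kernel_prod_right' hG) (by fun_prop)]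
  refine lintegral_congr fun f => ?_
  rw [lintegral_countable']
  refine tsum_congr fun y => ?_
  have hk : jumpKernel s L ω n (Preorder.frestrictLe (π := fun _ => Vert L) n f) {y} =
      jumpPMF s L ω (f n) y :=
    PMF.toMeasure_apply_singleton _ _ (measurableSet_singleton _)
  rw [hk, mul_comm]
  rfl

theorem lintegral_chainLaw_zero (s : ℤ) (ω : Env) (x : Vert L) (u : Vert L → ℝ≥0∞) :
    ∫⁻ f, u (f 0) ∂chainLaw s L ω x = u x := by
  have h1 : chainLaw s L ω x {f | f 0 = x} = 1 := by
    have := chainLaw_path s L ω x (fun _ => x) 0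
    simpa using this
  have h2 : ∀ᵐ f ∂chainLaw s L ω x, f 0 = x := 
    (prob_compl_eq_zero_iff (measurableSet_eval_eq 0 x)).2 h1
  rw [lintegral_congr_ae (g := fun _ => u x) (h2.mono fun f hf => by simp [hf])]
  simp

theorem ae_chainLaw_adj {s : ℤ} {ω : Env} (h0 : ∀ y, totalRate s L ω y ≠ 0) (x : Vert L) :
    ∀ᵐ f ∂chainLaw s L ω x, ∀ n, ∑ i, |(f n).1 i - (f (n + 1)).1 i| = 1 := by
  rw [ae_all_iff]
  intro n
  obtain ⟨g, hg⟩ : ∃ g : Vert L → Vert L → ℝ≥0∞, ∀ y y', g y y' = 0 ↔ ∑ i, |y.1 i - y'.1 i| = 1 :=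
    ⟨fun y y' => if ∑ i, |y.1 i - y'.1 i| = 1 then 0 else 1, fun y y' => by simp⟩
  have h := lintegral_chainLaw_succ s ω x n g
  have h1 : ∀ y : Vert L, ∑' y', jumpPMF s L ω y y' * g y y' = 0 := fun y => by
    rw [ENNReal.tsum_eq_zero]
    intro y'
    by_cases hy : ∑ i, |y.1 i - y'.1 i| = 1
    · rw [(hg y y').2 hy, mul_zero]
    · rw [not_not.1 (mt (jumpPMF_ne_zero_iff (h0 y) y').1 hy), zero_mul]
  simp only [h1, lintegral_zero] at h
  have hgm : Measurable fun q : Vert L × Vert L => g q.1 q.2 := measurable_of_countable _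
  have he : Measurable fun f : ℕ → Vert L => (f n, f (n + 1)) :=
    (measurable_pi_apply n).prodMk (measurable_pi_apply (n + 1))
  have hgm' : Measurable fun f : ℕ → Vert L => g (f n) (f (n + 1)) := hgm.comp he
  rw [lintegral_eq_zero_iff hgm'] at h
  exact h.mono fun f hf => (hg _ _).1 hf

theorem lintegral_excessive_le {s : ℤ} {ω : Env} {u : Vert L → ℝ≥0∞}
    (hu : ∀ y, ∑' y', jumpPMF s L ω y y' * u y' ≤ u y) (x : Vert L) (n : ℕ) :
    ∫⁻ f, u (f n) ∂chainLaw s L ω x ≤ u x := by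
  induction n with
  | zero => exact (lintegral_chainLaw_zero s ω x u).le
  | succ n ih =>
    rw [lintegral_chainLaw_succ s ω x n fun _ y => u y]
    refine le_trans (lintegral_mono (g := fun f => u (f n)) fun f => ?_) ih
    exact hu (f n)

/-- The defect of an excessive function `u` from being harmonic, summed along the chain, has
expectation at most `u x`. -/
theorem tsum_lintegral_defect_le {s : ℤ} {ω : Env} {u : Vert L → ℝ≥0∞}
    (hu : ∀ y, ∑' y', jumpPMF s L ω y y' * u y' ≤ u y) (x : Vert L) :
    ∑' n, ∫⁻ f, (u (f n) - ∑' y', jumpPMF s L ω (f n) y' * u y') ∂chainLaw s L ω x ≤ u x := by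
  set P : Vert L → ℝ≥0∞ := fun y => ∑' y', jumpPMF s L ω y y' * u y' with hP
  have h : ∀ m : ℕ, ∑ n ∈ Finset.range m, ∫⁻ f, (u (f n) - P (f n)) ∂chainLaw s L ω x +
      ∫⁻ f, u (f m) ∂chainLaw s L ω x = u x := by
    intro m
    induction m with
    | zero => simpa using lintegral_chainLaw_zero s ω x u
    | succ m ih =>
      rw [Finset.sum_range_succ, add_assoc, lintegral_chainLaw_succ s ω x m fun _ y => u y,
        ← lintegral_add_right _ (measurable_eval_of_countable P m)]
      have hcancel : ∀ y, u y - P y + P y = u y := fun y => tsub_add_cancel_of_le (hu y)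
      simp only [hcancel]
      exact ih
  rw [ENNReal.tsum_eq_iSup_nat]
  exact iSup_le fun m => (le_self_add).trans (h m).le

/-- A vertex at which some finite excessive function is not harmonic has finite Green function. -/
theorem tsum_chainLaw_ne_top_of_defect {s : ℤ} {ω : Env} {u : Vert L → ℝ≥0∞}
    (hu : ∀ y, ∑' y', jumpPMF s L ω y y' * u y' ≤ u y) {x y : Vert L}
    (hx : u x ≠ ∞)
    (hy : ∑' y', jumpPMF s L ω y y' * u y' < u y) :
    ∑' n, chainLaw s L ω x {f | f n = y} ≠ ∞ := by
  set d := u y - ∑' y', jumpPMF s L ω y y' * u y' with hd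
  have hd0 : d ≠ 0 := (tsub_pos_of_lt hy).ne'
  have h : d * ∑' n, chainLaw s L ω x {f | f n = y} ≤ u x := by
    rw [← ENNReal.tsum_mul_left]
    refine (ENNReal.tsum_le_tsum fun n => ?_).trans (tsum_lintegral_defect_le hu x)
    rw [← lintegral_indicator_const (measurableSet_eval_eq n y)]
    refine lintegral_mono (Set.indicator_le fun f hf => ?_)
    have hf' : f n = y := hf
    rw [hf']
  intro htop
  rw [htop, ENNReal.mul_top hd0] at h
  exact hx (top_le_iff.1 h)

/-- The probability of escaping to the left is at most the value at the starting point of any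
excessive function that equals `1` far to the left. -/
theorem chainLaw_tendsto_atBot_le {s : ℤ} {ω : Env} {u : Vert L → ℝ≥0∞}
    (hu : ∀ y, ∑' y', jumpPMF s L ω y y' * u y' ≤ u y)
    {a : ℤ} (ha : ∀ y : Vert L, y.1 0 ≤ a → u y = 1) (x : Vert L) :
    chainLaw s L ω x {f | Tendsto (fun n => (f n).1 0) atTop atBot} ≤ u x := by
  have hms : MeasurableSet {f : ℕ → Vert L | Tendsto (fun n => (f n).1 0) atTop atBot} :=
    measurableSet_tendsto atBot (measurable_eval_of_countable fun y : Vert L => y.1 0)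
  rw [← lintegral_indicator_one hms]
  calc _ ≤ ∫⁻ f, liminf (fun n => u (f n)) atTop ∂chainLaw s L ω x := by
        refine lintegral_mono (Set.indicator_le fun f hf => ?_)
        have hf' : Tendsto (fun n => (f n).1 0) atTop atBot := hf
        refine le_liminf_of_le (by isBoundedDefault) ?_
        filter_upwards [hf'.eventually_le_atBot a] with n hn
        rw [ha _ hn]
        rfl
    _ ≤ liminf (fun n => ∫⁻ f, u (f n) ∂chainLaw s L ω x) atTop :=
        lintegral_liminf_le (measurable_eval_of_countable u)
    _ ≤ u x := liminf_le_of_le (by isBoundedDefault) fun b hb => by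
        obtain ⟨n, hn⟩ := hb.exists
        exact hn.trans (lintegral_excessive_le hu x n)

/-- Finiteness of the Green function propagates backwards along possible jumps. -/
theorem tsum_chainLaw_ne_top_of_jump {s : ℤ} {ω : Env} {x y y' : Vert L}
    (hyy' : jumpPMF s L ω y' y ≠ 0) (hy : ∑' n, chainLaw s L ω x {f | f n = y} ≠ ∞) :
    ∑' n, chainLaw s L ω x {f | f n = y'} ≠ ∞ := by
  classical
  have h : jumpPMF s L ω y' y * ∑' n, chainLaw s L ω x {f | f n = y'} ≤
      ∑' n, chainLaw s L ω x {f | f n = y} := by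
    rw [← ENNReal.tsum_mul_left]
    refine (ENNReal.tsum_le_tsum fun n => ?_).trans
      (ENNReal.tsum_comp_le_tsum_of_injective (add_left_injective 1) _)
    rw [← lintegral_indicator_const (measurableSet_eval_eq n y'),
      ← lintegral_indicator_one (measurableSet_eval_eq (n + 1) y)]
    have h1 := lintegral_chainLaw_succ s ω x n fun _ z => if z = y then 1 else 0
    have h2 : ∀ f : ℕ → Vert L, ({f : ℕ → Vert L | f (n + 1) = y}.indicator 1 f : ℝ≥0∞) =
        if f (n + 1) = y then 1 else 0 := fun f => by simp [Set.indicator]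
    simp only [h2, h1]
    refine lintegral_mono (Set.indicator_le fun f hf => ?_)
    have hf' : f n = y' := hf
    rw [hf']
    refine le_trans ?_ (ENNReal.le_tsum y)
    simp
  intro htop
  rw [htop, ENNReal.mul_top hyy', top_le_iff] at h
  exact hy h

/-- An integer sequence with increments at most `1` in absolute value that takes every value finitely
often tends to `+∞` or to `-∞`. -/
theorem tendsto_atTop_or_atBot_of_steps {l : ℕ → ℤ} (h1 : ∀ n, |l n - l (n + 1)| ≤ 1)
    (h2 : ∀ z, ∀ᶠ n in atTop, l n ≠ z) : Tendsto l atTop atTop ∨ Tendsto l atTop atBot := by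
  have h3 : ∀ b : ℤ, ∀ᶠ n in atTop, b < |l n| := fun b => by
    have := (Filter.eventually_all_finset (Finset.Icc (-b) b)).2 fun z _ => h2 z
    filter_upwards [this] with n hn
    by_contra! hle
    exact hn (l n) (Finset.mem_Icc.2 (abs_le.1 hle)) rfl
  obtain ⟨m, hm⟩ := eventually_atTop.1 (h2 0)
  -- After time `m` the sequence avoids `0`, hence cannot change its sign.
  rcases lt_or_gt_of_ne (hm m le_rfl) with hneg | hpos
  · have h4 : ∀ n ≥ m, l n < 0 := fun n hn => by
      induction n, hn using Nat.le_induction with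
      | base => exact hneg
      | succ n hn ih =>
        have := hm (n + 1) (by omega)
        have := abs_le.1 (h1 n)
        omega
    refine Or.inr (tendsto_atBot.2 fun b => ?_)
    filter_upwards [h3 (-b), eventually_ge_atTop m] with n hn hnm
    rw [abs_of_neg (h4 n hnm)] at hn
    omega
  · have h4 : ∀ n ≥ m, 0 < l n := fun n hn => by
      induction n, hn using Nat.le_induction with
      | base => exact hpos
      | succ n hn ih =>
        have := hm (n + 1) (by omega)
        have := abs_le.1 (h1 n)
        omega
    refine Or.inl (tendsto_atTop.2 fun b => ?_)
    filter_upwards [h3 b, eventually_ge_atTop m] with n hn hnm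
    rw [abs_of_pos (h4 n hnm)] at hn
    omega

/-- An excessive function that equals `1` far to the left and vanishes to the right is not harmonic
everywhere, by the maximum principle. -/
theorem exists_defect {s : ℤ} {ω : Env}
    (hi : ((spiderGraph s L ω).induce {u | u.1 ∈ localConf L 0}).Connected)
    (hii : ∃ u v : Vert L, u.1 ∈ localConf L 0 ∧ v.1 ∈ localConf L 1 ∧ (spiderGraph s L ω).Adj u v)
    {u : Vert L → ℝ≥0∞} (hu1 : ∀ y, u y ≤ 1) {a : ℤ} (ha : ∀ y : Vert L, y.1 0 ≤ a → u y = 1)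
    (h0 : Tendsto u (toRight L) (𝓝 0)) :
    ∃ y, ∑' y', jumpPMF s L ω y y' * u y' < u y := by
  by_contra! hcon
  obtain ⟨K, w, hw, -⟩ := exists_variation_bound hi hii
  have hone : ∀ y, u y = 1 := by
    refine forall_of_adj hi hii (Q := fun y => u y = 1) (fun y y' hyy' hy => ?_)
      (ha (w a) (hw a).le)
    by_contra hne
    have hlt : u y' < 1 := lt_of_le_of_ne (hu1 y') hne
    have hj := (jumpPMF_ne_zero_iff (totalRate_ne_zero (s := s) (ω := ω) hyy') y').2 hyy'
    have hsum : ∑' z, jumpPMF s L ω y z * u z < ∑' z, jumpPMF s L ω y z := by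
      refine ENNReal.tsum_lt_tsum (i := y') ?_ (fun z => mul_le_of_le_one_right' (hu1 z)) ?_
      · exact ne_top_of_le_ne_top ENNReal.one_ne_top ((ENNReal.tsum_le_tsum fun z =>
          mul_le_of_le_one_right' (hu1 z)).trans (PMF.tsum_coe _).le)
      · calc _ < jumpPMF s L ω y y' * 1 :=
              ENNReal.mul_lt_mul_right hj (PMF.apply_ne_top _ _) hlt
          _ = _ := mul_one _
    rw [PMF.tsum_coe] at hsum
    exact absurd ((hcon y).trans_lt hsum) (by simp [hy])
  have hw' : Tendsto w atTop (toRight L) := tendsto_comap_iff.2 <| by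
    simp only [Function.comp_def, hw]
    exact tendsto_id
  have h := h0.comp hw'
  simp only [Function.comp_def, hone] at h
  exact one_ne_zero (tendsto_nhds_unique tendsto_const_nhds h)

/-- In an environment whose potential increases fast enough to the right and tends to `-∞` to the
left, the jump chain is transient to the right. -/
theorem ae_chainLaw_tendsto_atTop {s : ℤ} (hs : s = 0 ∨ s = 1) {ω : Env}
    (hi : ((spiderGraph s L ω).induce {u | u.1 ∈ localConf L 0}).Connected)
    (hii : ∃ u v : Vert L, u.1 ∈ localConf L 0 ∧ v.1 ∈ localConf L 1 ∧ (spiderGraph s L ω).Adj u v)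
    {U : ℤ → ℝ} (hU : ∀ z, U (z + 1) = U z + Real.log (ω (z + 1) / (1 - ω (z + 1)))) {δ B : ℝ}
    (hδ : 0 < δ) (hω : ∀ z, δ ≤ ω z ∧ (ω z : ℝ) ≤ 1 - δ) (hB : ∀ z, |U (z + 1) - U z| ≤ B)
    (hUs : Summable fun n : ℕ => Real.exp (-(N * U n / 2))) (hUbot : Tendsto U atBot atBot)
    (x : Vert L) : ∀ᵐ f ∂chainLaw s L ω x, Tendsto (fun n => (f n).1 0) atTop atTop := by
  have hrate : ∀ y, totalRate s L ω y ≠ 0 := fun y => by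
    obtain ⟨y', hy'⟩ := exists_adj hi hii y
    exact totalRate_ne_zero hy'
  have hex := fun ε : ℝ => exists_excessive hs hi hii hU hδ hω hB hUs hUbot x (ε := ε)
  have hgreen : ∀ y, ∑' n, chainLaw s L ω x {f | f n = y} ≠ ∞ := by
    obtain ⟨a, u, hu1, ha, -, h0, hu⟩ := hex 1 one_pos
    obtain ⟨y₀, hy₀⟩ := exists_defect hi hii hu1 ha h0
    refine forall_of_adj hi hii (Q := fun y => ∑' n, chainLaw s L ω x {f | f n = y} ≠ ∞)
      (fun y y' hyy' => tsum_chainLaw_ne_top_of_jump ?_)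
      (tsum_chainLaw_ne_top_of_defect hu (ne_top_of_le_ne_top ENNReal.one_ne_top (hu1 x)) hy₀)
    rw [jumpPMF_ne_zero_iff (hrate y')]
    simpa only [abs_sub_comm] using hyy'
  have hleft : ∀ᵐ f ∂chainLaw s L ω x, ¬ Tendsto (fun n => (f n).1 0) atTop atBot := by
    rw [ae_iff]
    simp only [not_not]
    refine le_antisymm (ENNReal.le_of_forall_pos_le_add fun ε hε _ => ?_) zero_le
    obtain ⟨a, u, -, ha, hux, -, hu⟩ := hex ε hε
    simpa using (chainLaw_tendsto_atBot_le hu ha x).trans hux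
  have hvisits : ∀ᵐ f ∂chainLaw s L ω x, ∀ y, ∀ᶠ n in atTop, f n ≠ y :=
    ae_all_iff.2 fun y => ae_eventually_notMem (hgreen y)
  filter_upwards [hleft, hvisits, ae_chainLaw_adj hrate x] with f h1 h2 h3
  refine (tendsto_atTop_or_atBot_of_steps
    (fun n => abs_sub_le_one_of_sum_abs_eq_one (h3 n) 0) fun z => ?_).resolve_right h1
  have := (Filter.eventually_all_finite (finite_level L z)).2 fun y _ => h2 y
  filter_upwards [this] with n hn hz
  exact hn (f n) hz rfl

end Chain

/-! ### The environment and the potential -/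

section Environment

/-- The strong law of large numbers along a subfamily of the coordinates of a product measure. -/
theorem ae_tendsto_average_infinitePi {ι X : Type*} [MeasurableSpace X] (ν : Measure X)
    [IsProbabilityMeasure ν] {φ : X → ℝ} (hm : Measurable φ) (hint : Integrable φ ν) {j : ℕ → ι}
    (hj : Function.Injective j) :
    ∀ᵐ ω ∂Measure.infinitePi (fun _ : ι => ν),
      Tendsto (fun n : ℕ => (∑ i ∈ Finset.range n, φ (ω (j i))) / n) atTop (𝓝 (∫ t, φ t ∂ν)) := by
  have hmp := fun i : ι => measurePreserving_eval_infinitePi (fun _ : ι => ν) i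
  have hindep : iIndepFun (fun (i : ℕ) (ω : ι → X) => φ (ω (j i)))
      (Measure.infinitePi fun _ : ι => ν) :=
    (iIndepFun_infinitePi (P := fun _ : ι => ν) (X := fun _ => φ) fun _ => hm).precomp hj
  have hmap : ∀ i : ι, (Measure.infinitePi fun _ : ι => ν).map (fun ω => φ (ω i)) = ν.map φ := by
    intro i
    conv_rhs => rw [← (hmp i).map_eq, Measure.map_map hm (measurable_pi_apply i)]
    rfl
  have h := strong_law_ae_real (μ := Measure.infinitePi fun _ : ι => ν)
    (fun (i : ℕ) ω => φ (ω (j i))) ((hmp (j 0)).integrable_comp_of_integrable hint)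
    (fun a b hab => hindep.indepFun hab)
    (fun i => ⟨(hm.comp (measurable_pi_apply _)).aemeasurable,
      (hm.comp (measurable_pi_apply _)).aemeasurable, by rw [hmap, hmap]⟩)
  have hexp : ∫ ω, φ (ω (j 0)) ∂Measure.infinitePi (fun _ : ι => ν) = ∫ t, φ t ∂ν := by
    rw [← integral_map (φ := fun ω : ι → X => φ (ω (j 0))) (f := fun x : ℝ => x)
      (hm.comp (measurable_pi_apply _)).aemeasurable (by fun_prop), hmap,
      integral_map hm.aemeasurable (by fun_prop)]
  rw [hexp] at h
  exact h

/-- The potential of the environment: it vanishes at `0` and has increments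
`log (ω_x / (1 - ω_x)) = -log ρ_x`. -/
def potential (ω : Env) (z : ℤ) : ℝ :=
  ∑ k ∈ Finset.range z.toNat, Real.log (ω (k + 1) / (1 - ω (k + 1))) -
    ∑ k ∈ Finset.range (-z).toNat, Real.log (ω (-k) / (1 - ω (-k)))

theorem potential_add_one (ω : Env) (z : ℤ) :
    potential ω (z + 1) = potential ω z + Real.log (ω (z + 1) / (1 - ω (z + 1))) := by
  unfold potential
  rcases le_or_gt 0 z with hz | hz
  · obtain ⟨n, rfl⟩ := Int.eq_ofNat_of_zero_le hz
    have h1 : (-((n : ℤ) + 1)).toNat = 0 := by omega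
    have h2 : ((n : ℤ) + 1).toNat = n + 1 := by omega
    have h3 : (-(n : ℤ)).toNat = 0 := by omega
    rw [h1, h2, h3, Finset.sum_range_succ]
    simp
  · obtain ⟨n, hn⟩ := Int.eq_ofNat_of_zero_le (a := -z - 1) (by omega)
    obtain rfl : z = -n - 1 := by omega
    have h1 : (-(n : ℤ) - 1 + 1).toNat = 0 := by omega
    have h2 : (-(n : ℤ) - 1).toNat = 0 := by omega
    have h3 : (-(-(n : ℤ) - 1)).toNat = n + 1 := by omega
    have h4 : (-(-(n : ℤ) - 1 + 1)).toNat = n := by omega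
    rw [h1, h2, h3, h4, Finset.sum_range_succ]
    simp

theorem abs_log_div_one_sub_le {δ t : ℝ} (hδ : 0 < δ) (h : δ ≤ t ∧ t ≤ 1 - δ) :
    |Real.log (t / (1 - t))| ≤ -(2 * Real.log δ) := by
  have h1 : Real.log δ ≤ Real.log t := Real.log_le_log hδ h.1
  have h2 : Real.log δ ≤ Real.log (1 - t) := Real.log_le_log hδ (by linarith)
  have h3 : Real.log t ≤ 0 := Real.log_nonpos (by linarith) (by linarith)
  have h4 : Real.log (1 - t) ≤ 0 := Real.log_nonpos (by linarith) (by linarith)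
  rw [Real.log_div (by linarith) (by linarith), abs_le]
  constructor <;> linarith

/-- If the averages of `ξ` converge to a positive limit, then its partial sums grow linearly. -/
theorem eventually_mul_le_sum {ξ : ℕ → ℝ} {v : ℝ} (hv : 0 < v)
    (h : Tendsto (fun n : ℕ => (∑ i ∈ Finset.range n, ξ i) / n) atTop (𝓝 v)) :
    ∀ᶠ n : ℕ in atTop, v / 2 * n ≤ ∑ i ∈ Finset.range n, ξ i := by
  filter_upwards [h.eventually_const_le (half_lt_self hv), eventually_gt_atTop 0] with n hn hn0
  rwa [le_div_iff₀ (by exact_mod_cast hn0)] at hn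

theorem tendsto_sum_atTop_of_average {ξ : ℕ → ℝ} {v : ℝ} (hv : 0 < v)
    (h : Tendsto (fun n : ℕ => (∑ i ∈ Finset.range n, ξ i) / n) atTop (𝓝 v)) :
    Tendsto (fun n : ℕ => ∑ i ∈ Finset.range n, ξ i) atTop atTop :=
  tendsto_atTop_mono' _ (eventually_mul_le_sum hv h)
    (tendsto_natCast_atTop_atTop.const_mul_atTop (half_pos hv))

theorem potential_natCast (ω : Env) (n : ℕ) : potential ω n =
    ∑ k ∈ Finset.range n, Real.log (ω (k + 1) / (1 - ω (k + 1))) := by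
  simp [potential]

theorem summable_exp_neg_potential {N : ℕ} (hN : 0 < N) {ω : Env} {v : ℝ} (hv : 0 < v)
    (h : Tendsto (fun n : ℕ => (∑ k ∈ Finset.range n,
      Real.log (ω (k + 1) / (1 - ω (k + 1)))) / n) atTop (𝓝 v)) :
    Summable fun n : ℕ => Real.exp (-(N * potential ω n / 2)) := by
  have hN' : (0 : ℝ) < N := by exact_mod_cast hN
  have hgeo : Summable fun n : ℕ => Real.exp (n * -(N * v / 4)) :=
    Real.summable_exp_nat_mul_iff.2 (by
      have : 0 < N * v / 4 := by positivity
      linarith)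
  refine hgeo.of_norm_bounded_eventually_nat ?_
  filter_upwards [eventually_mul_le_sum hv h] with n hn
  rw [Real.norm_of_nonneg (Real.exp_pos _).le, potential_natCast, Real.exp_le_exp]
  have := mul_le_mul_of_nonneg_left hn hN'.le
  linarith

theorem tendsto_potential_atBot {ω : Env} {v : ℝ} (hv : 0 < v)
    (h : Tendsto (fun n : ℕ => (∑ k ∈ Finset.range n,
      Real.log (ω (-k) / (1 - ω (-k)))) / n) atTop (𝓝 v)) :
    Tendsto (potential ω) atBot atBot := by
  have h1 : Tendsto (fun z : ℤ => (-z).toNat) atBot atTop :=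
    tendsto_atTop.2 fun n => (eventually_le_atBot (-(n : ℤ))).mono fun z hz => by omega
  have h2 := tendsto_neg_atTop_atBot.comp ((tendsto_sum_atTop_of_average hv h).comp h1)
  refine h2.congr' ?_
  filter_upwards [eventually_le_atBot 0] with z hz
  simp [potential, Int.toNat_of_nonpos hz]

/-- Almost every environment is uniformly elliptic, and its potential grows linearly. -/
theorem ae_envLaw_potential (μ : Measure (Set.Ioo (0 : ℝ) 1)) [IsProbabilityMeasure μ] (s : ℤ)
    (hiii : ∫ ω, Real.log (wMinus ω 0 / wPlus s ω 0) ∂envLaw μ < 0) {δ : ℝ} (hδ : 0 < δ)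
    (hiv : ∀ᵐ ω ∂envLaw μ, δ ≤ wPlus s ω 0 ∧ wPlus s ω 0 ≤ 1 - δ) {N : ℕ} (hN : 0 < N) :
    ∀ᵐ ω ∂envLaw μ, (∀ z, δ ≤ ω z ∧ (ω z : ℝ) ≤ 1 - δ) ∧
      Summable (fun n : ℕ => Real.exp (-(N * potential ω n / 2))) ∧
      Tendsto (potential ω) atBot atBot := by
  have hmp := fun i : ℤ => measurePreserving_eval_infinitePi (fun _ : ℤ => μ) i
  have hset : MeasurableSet {t : Set.Ioo (0 : ℝ) 1 | δ ≤ (t : ℝ) ∧ (t : ℝ) ≤ 1 - δ} :=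
    (measurableSet_le measurable_const measurable_subtype_coe).inter
      (measurableSet_le measurable_subtype_coe measurable_const)
  have hμ : ∀ᵐ (t : Set.Ioo (0 : ℝ) 1) ∂μ, δ ≤ (t : ℝ) ∧ (t : ℝ) ≤ 1 - δ := by
    rw [← (hmp s).map_eq]
    refine (ae_map_iff (hmp s).measurable.aemeasurable hset).2 ?_
    simpa [wPlus, envLaw] using hiv
  have hell : ∀ᵐ ω ∂envLaw μ, ∀ z, δ ≤ (ω z : ℝ) ∧ (ω z : ℝ) ≤ 1 - δ :=
    ae_all_iff.2 fun z => (hmp z).quasiMeasurePreserving.ae hμ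
  have hm1 : Measurable fun t : Set.Ioo (0 : ℝ) 1 => Real.log t :=
    Real.measurable_log.comp measurable_subtype_coe
  have hm2 : Measurable fun t : Set.Ioo (0 : ℝ) 1 => Real.log (1 - t) :=
    Real.measurable_log.comp (measurable_const.sub measurable_subtype_coe)
  have hint1 : Integrable (fun t : Set.Ioo (0 : ℝ) 1 => Real.log t) μ := by
    refine Integrable.of_bound hm1.aestronglyMeasurable (-Real.log δ) ?_
    filter_upwards [hμ] with t ht
    rw [Real.norm_eq_abs, abs_of_nonpos (Real.log_nonpos t.2.1.le t.2.2.le)]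
    exact neg_le_neg (Real.log_le_log hδ ht.1)
  have hint2 : Integrable (fun t : Set.Ioo (0 : ℝ) 1 => Real.log (1 - t)) μ := by
    refine Integrable.of_bound hm2.aestronglyMeasurable (-Real.log δ) ?_
    filter_upwards [hμ] with t ht
    rw [Real.norm_eq_abs, abs_of_nonpos
      (Real.log_nonpos (by linarith [t.2.2]) (by linarith [t.2.1]))]
    exact neg_le_neg (Real.log_le_log hδ (by linarith))
  have hev : ∀ (g : Set.Ioo (0 : ℝ) 1 → ℝ), Measurable g → ∀ i : ℤ,
      ∫ ω, g (ω i) ∂envLaw μ = ∫ t, g t ∂μ := fun g hg i => by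
    conv_rhs => rw [← (hmp i).map_eq]
    rw [integral_map (measurable_pi_apply i).aemeasurable hg.aestronglyMeasurable]
    rfl
  have hlog : ∀ t : Set.Ioo (0 : ℝ) 1,
      Real.log (t / (1 - t)) = Real.log t - Real.log (1 - t) := fun t =>
    Real.log_div t.2.1.ne' (sub_pos.2 t.2.2).ne'
  have hv : 0 < ∫ t : Set.Ioo (0 : ℝ) 1, Real.log (t / (1 - t)) ∂μ := by
    have h1 : ∫ ω, Real.log (wMinus ω 0 / wPlus s ω 0) ∂envLaw μ =
        ∫ ω, (Real.log (1 - ω 0) - Real.log (ω s)) ∂envLaw μ := by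
      refine integral_congr_ae (ae_of_all _ fun ω => ?_)
      simp only [wMinus, wPlus, zero_add]
      exact Real.log_div (sub_pos.2 (ω 0).2.2).ne' (ω s).2.1.ne'
    have h2 : Integrable (fun ω : Env => Real.log (1 - ω 0)) (envLaw μ) :=
      (hmp 0).integrable_comp_of_integrable hint2
    have h3 : Integrable (fun ω : Env => Real.log (ω s)) (envLaw μ) :=
      (hmp s).integrable_comp_of_integrable hint1
    rw [h1, integral_sub h2 h3,
      hev (fun t => Real.log (1 - t)) hm2 0, hev (fun t => Real.log t) hm1 s] at hiii
    simp only [hlog]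
    rw [integral_sub hint1 hint2]
    linarith
  have hm : Measurable fun t : Set.Ioo (0 : ℝ) 1 => Real.log (t / (1 - t)) := by
    simp only [hlog]
    exact hm1.sub hm2
  have hint : Integrable (fun t : Set.Ioo (0 : ℝ) 1 => Real.log (t / (1 - t))) μ := by
    simp only [hlog]
    exact hint1.sub hint2
  have hright := ae_tendsto_average_infinitePi μ hm hint (j := fun k : ℕ => (k : ℤ) + 1)
    fun a b hab => by simpa using hab
  have hleft := ae_tendsto_average_infinitePi μ hm hint (j := fun k : ℕ => -(k : ℤ))
    fun a b hab => by simpa using hab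
  filter_upwards [hell, hright, hleft] with ω h1 h2 h3
  exact ⟨h1, summable_exp_neg_potential hN hv h2, tendsto_potential_atBot hv h3⟩

end Environment

/-! ### From the jump chain to continuous time -/

section TimeChange

/-- The holding times of rate `1` do not accumulate: infinitely many of them exceed `1`. -/
theorem ae_tsum_exponential_eq_top :
    ∀ᵐ e ∂Measure.infinitePi (fun _ : ℕ => expMeasure 1), ∑' k, ENNReal.ofReal (e k) = ∞ := by
  have hpos : 0 < ∫ t, (Set.Ioi (1 : ℝ)).indicator (1 : ℝ → ℝ) t ∂expMeasure 1 := by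
    rw [integral_indicator_one measurableSet_Ioi, ← Set.compl_Iic,
      probReal_compl_eq_one_sub measurableSet_Iic, ← cdf_eq_real, cdf_expMeasure_eq one_pos]
    simp [Real.exp_pos]
  have h := ae_tendsto_average_infinitePi (expMeasure 1)
    (φ := (Set.Ioi (1 : ℝ)).indicator (1 : ℝ → ℝ)) (measurable_one.indicator measurableSet_Ioi)
    ((integrable_const (1 : ℝ)).indicator measurableSet_Ioi) (j := (id : ℕ → ℕ))
    Function.injective_id
  filter_upwards [h] with e he
  by_contra htop
  obtain ⟨n, hn⟩ := ((tendsto_sum_atTop_of_average hpos he).eventually_gt_atTop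
    (∑' k, ENNReal.ofReal (e k)).toReal).exists
  refine hn.not_ge ?_
  have hind : ∀ i, (Set.Ioi (1 : ℝ)).indicator (1 : ℝ → ℝ) (e i) ≤ max (e i) 0 := fun i => by
    by_cases hi : 1 < e i
    · simp [hi, hi.le]
    · simp [hi]
  rw [← ENNReal.ofReal_le_iff_le_toReal htop]
  calc _ ≤ ENNReal.ofReal (∑ i ∈ Finset.range n, max (e i) 0) :=
        ENNReal.ofReal_le_ofReal (Finset.sum_le_sum fun i _ => hind i)
    _ = ∑ i ∈ Finset.range n, ENNReal.ofReal (e i) := by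
        rw [ENNReal.ofReal_sum_of_nonneg fun i _ => le_max_right _ _]
        exact Finset.sum_congr rfl fun i _ => by simp [ENNReal.ofReal_max]
    _ ≤ _ := ENNReal.sum_le_tsum _

variable {N : ℕ} [NeZero N] {L : Finset (Fin N → ℤ)}

/-- Each of the `N` legs can make at most two jumps, each at rate at most `1`. -/
theorem totalRate_le (s : ℤ) (ω : Env) (x : Vert L) : totalRate s L ω x ≤ (N * 2 : ℕ) := by
  classical
  set T : Finset (Fin N → ℤ) := (Finset.univ : Finset (Fin N × Bool)).image fun p =>
    Function.update x.1 p.1 (if p.2 then x.1 p.1 + 1 else x.1 p.1 - 1) with hT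
  have hcard : T.card ≤ N * 2 := by
    refine Finset.card_image_le.trans (le_of_eq ?_)
    simp
  calc totalRate s L ω x ≤ ∑' y : Fin N → ℤ, ENNReal.ofReal (rate s ω x.1 y) :=
        ENNReal.tsum_comp_le_tsum_of_injective Subtype.val_injective
          fun y => ENNReal.ofReal (rate s ω x.1 y)
    _ = ∑ y ∈ T, ENNReal.ofReal (rate s ω x.1 y) := by
        refine tsum_eq_sum fun y hy => ?_
        rw [rate_of_sum_abs_ne_one, ENNReal.ofReal_zero]
        intro h
        obtain ⟨i, hi | hi⟩ := exists_update_of_sum_abs_eq_one h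
        · exact hy (Finset.mem_image.2 ⟨(i, true), Finset.mem_univ _, by simp [hi]⟩)
        · exact hy (Finset.mem_image.2 ⟨(i, false), Finset.mem_univ _, by simp [hi]⟩)
    _ ≤ T.card • (1 : ℝ≥0∞) := by
        refine Finset.sum_le_card_nsmul _ _ _ fun y _ => ENNReal.ofReal_le_one.2 ?_
        by_cases h : ∑ i, |x.1 i - y i| = 1
        · exact (rate_mem_Icc (δ := 0)
            (fun z => ⟨(ω z).2.1.le, by linarith [(ω z).2.2]⟩) h).2
        · rw [rate_of_sum_abs_ne_one _ _ h]
          exact zero_le_one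
    _ ≤ (N * 2 : ℕ) := by
        rw [nsmul_one]
        exact_mod_cast hcard

/-- If the jump chain goes to the right and the holding times do not accumulate, then the spider goes
to the right. -/
theorem tendsto_spider {s : ℤ} {ω : Env} (h0 : ∀ y, totalRate s L ω y ≠ 0)
    {p : (ℕ → Vert L) × (ℕ → ℝ)} (h1 : Tendsto (fun n => (p.1 n).1 0) atTop atTop)
    (h2 : ∑' k, ENNReal.ofReal (p.2 k) = ∞) :
    Tendsto (fun t : ℝ≥0 => (spider s L ω p t).1 0) atTop atTop := by
  have hfin : ∀ n, jumpTime s L ω p n ≠ ∞ := fun n =>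
    ENNReal.sum_ne_top.2 fun k _ => ENNReal.div_ne_top ENNReal.ofReal_ne_top (h0 _)
  have hmono : Monotone (jumpTime s L ω p) := fun m n hmn =>
    Finset.sum_le_sum_of_subset (Finset.range_mono hmn)
  have hN : (0 : ℝ≥0∞) < (N * 2 : ℕ) := by
    exact_mod_cast Nat.mul_pos (Nat.pos_of_ne_zero (NeZero.ne N)) two_pos
  -- Nonemptiness excludes the junk value `sInf ∅ = 0` in the definition of `spider`.
  have hex : ∀ t : ℝ≥0, {n : ℕ | (t : ℝ≥0∞) < jumpTime s L ω p (n + 1)}.Nonempty := by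
    intro t
    by_contra hne
    rw [Set.not_nonempty_iff_eq_empty, Set.eq_empty_iff_forall_notMem] at hne
    have hle : ∀ n, jumpTime s L ω p n ≤ t := fun n =>
      (hmono (Nat.le_succ n)).trans (not_lt.1 (hne n))
    have htop : ∑' k, ENNReal.ofReal (p.2 k) / ((N * 2 : ℕ) : ℝ≥0∞) ≤ t := by
      rw [ENNReal.tsum_eq_iSup_nat]
      refine iSup_le fun n => le_trans ?_ (hle n)
      exact Finset.sum_le_sum fun k _ => ENNReal.div_le_div_left (totalRate_le s ω _) _
    simp only [div_eq_mul_inv] at htop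
    rw [ENNReal.tsum_mul_right, h2,
      ENNReal.top_mul (ENNReal.inv_ne_zero.2 (ENNReal.natCast_ne_top _))] at htop
    exact ENNReal.coe_ne_top (top_le_iff.1 htop)
  have hn : Tendsto (fun t : ℝ≥0 => sInf {n : ℕ | (t : ℝ≥0∞) < jumpTime s L ω p (n + 1)})
      atTop atTop := by
    refine tendsto_atTop.2 fun m => ?_
    filter_upwards [eventually_ge_atTop (jumpTime s L ω p m).toNNReal] with t ht
    refine le_csInf (hex t) fun n hlt => ?_
    by_contra! hnm
    refine (lt_irrefl (t : ℝ≥0∞)) ?_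
    calc (t : ℝ≥0∞) < jumpTime s L ω p (n + 1) := hlt
      _ ≤ jumpTime s L ω p m := hmono hnm
      _ = ((jumpTime s L ω p m).toNNReal : ℝ≥0∞) := (ENNReal.coe_toNNReal (hfin m)).symm
      _ ≤ t := ENNReal.coe_le_coe.2 ht
  exact h1.comp hn

end TimeChange

end Spider

end

theorem proposition2p1 {N : ℕ} [NeZero N] (L : Finset (Fin N → ℤ)) (hL : ∀ z ∈ L, z 0 = 0)
    (s : ℤ) (hs : s = 0 ∨ s = 1)
    (μ : Measure (Set.Ioo (0 : ℝ) 1)) [IsProbabilityMeasure μ]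
    (hi : ∀ᵐ ω ∂Spider.envLaw μ,
      ((Spider.spiderGraph s L ω).induce {u | u.1 ∈ Spider.localConf L 0}).Connected)
    (hii : ∀ᵐ ω ∂Spider.envLaw μ, ∃ u v : Spider.Vert L,
      u.1 ∈ Spider.localConf L 0 ∧ v.1 ∈ Spider.localConf L 1 ∧ (Spider.spiderGraph s L ω).Adj u v)
    (hiii : ∫ ω, Real.log (Spider.wMinus ω 0 / Spider.wPlus s ω 0) ∂Spider.envLaw μ < 0)
    (hiv : ∃ δ : ℝ, 0 < δ ∧ δ < 1 / 2 ∧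
      ∀ᵐ ω ∂Spider.envLaw μ, δ ≤ Spider.wPlus s ω 0 ∧ Spider.wPlus s ω 0 ≤ 1 - δ)
    (x : Spider.Vert L) :
    ∀ᵐ z ∂Spider.annealedLaw μ s L x,
      Tendsto (fun t : ℝ≥0 => (Spider.spider s L z.1 z.2 t).1 0) atTop atTop := by
  open Spider in
  obtain ⟨δ, hδ, -, hell⟩ := hiv
  have henv := ae_envLaw_potential μ s hiii hδ hell (Nat.pos_of_ne_zero (NeZero.ne N))
  have hchain : MeasurableSet {f : ℕ → Vert L | Tendsto (fun n => (f n).1 0) atTop atTop} :=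
    measurableSet_tendsto atTop (measurable_eval_of_countable fun y : Vert L => y.1 0)
  have hclock : MeasurableSet {e : ℕ → ℝ | ∑' k, ENNReal.ofReal (e k) = ∞} :=
    (Measurable.tsum fun k => (measurable_pi_apply k).ennreal_ofReal) (measurableSet_singleton ∞)
  -- Which total rates vanish does not depend on the environment.
  have hrate : ∀ ω y, totalRate s L ω y ≠ 0 := by
    have : IsProbabilityMeasure (envLaw μ) := by
      unfold envLaw
      infer_instance
    obtain ⟨ω₀, h1, h2⟩ := (hi.and hii).exists
    intro ω y
    obtain ⟨y', hy'⟩ := exists_adj h1 h2 y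
    exact totalRate_ne_zero hy'
  have hgood : ∀ᵐ z ∂annealedLaw μ s L x,
      z.2 ∈ {f : ℕ → Vert L | Tendsto (fun n => (f n).1 0) atTop atTop} ×ˢ
        {e : ℕ → ℝ | ∑' k, ENNReal.ofReal (e k) = ∞} := by
    refine Measure.ae_compProd_of_ae_ae (measurable_snd (hchain.prod hclock)) ?_
    filter_upwards [henv, hi, hii] with ω ⟨h1, h2, h3⟩ h4 h5
    have hB : ∀ z, |potential ω (z + 1) - potential ω z| ≤ -(2 * Real.log δ) := fun z => by
      rw [potential_add_one, add_sub_cancel_left]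
      exact abs_log_div_one_sub_le hδ (h1 (z + 1))
    have h6 := ae_chainLaw_tendsto_atTop hs h4 h5 (potential_add_one ω) hδ h1 hB h2 h3 x
    have : IsMarkovKernel
        (⟨fun ω => chainLaw s L ω x, measurable_chainLaw s L x⟩ : Kernel Env (ℕ → Vert L)) :=
      ⟨fun ω => inferInstanceAs (IsProbabilityMeasure (chainLaw s L ω x))⟩
    rw [quenchedLaw, Kernel.prod_apply, Kernel.const_apply]
    filter_upwards [Measure.quasiMeasurePreserving_fst.ae h6,
      Measure.quasiMeasurePreserving_snd.ae ae_tsum_exponential_eq_top] with p h7 h8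
    exact ⟨h7, h8⟩
  filter_upwards [hgood] with z h
  exact tendsto_spider (hrate z.1) h.1 h.2
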